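/- Let $l>0$, let $V\in L^2[0,l]$ be real-valued, and let $\alpha,\beta,\theta\in\mathbb R$ with $\beta\neq0$. Let $\mathcal H=\bigoplus_{(m,n)\in\mathbb Z^2}\big(L^2[0,l]\oplus L^2[0,l]\big)$ be the Hilbert space of the square lattice graph, with elements $\phi=(\phi_{m,n,r},\phi_{m,n,u})$, where the edge $(m,n,r)$ joins the node $(m,n)$ to $(m+1,n)$ and the edge $(m,n,u)$ joins $(m,n)$ to $(m,n+1)$. Let $\Lambda$ be the self-adjoint operator in $\mathcal H$ acting on each edge as $\phi\mapsto-\phi''+V\phi$, on those $\phi\in\mathcal H$ with all components in $H^2[0,l]$ and with $(-\phi_e''+V\phi_e)_e\in\mathcal H$ that satisfy, for all $m,n\in\mathbb Z$, $$\phi_{m,n}:=\phi_{m,n,r}(0)=\tfrac1\beta\phi_{m,n,u}(0)=e^{-i\pi n\theta}\phi_{m-1,n,r}(l)=\tfrac1\beta e^{i\pi m\theta}\phi_{m,n-1,u}(l),$$ $$\phi'_{m,n,r}(0)+\beta\phi'_{m,n,u}(0)-e^{-i\pi n\theta}\phi'_{m-1,n,r}(l)-\beta e^{i\pi m\theta}\phi'_{m,n-1,u}(l)=\alpha\,\phi_{m,n}.$$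 Let $D$ be the operator $f\mapsto-f''+Vf$ in $L^2[0,l]$ with domain $\{f\in H^2[0,l]: f(0)=f(l)=0\}$; its eigenvalues $\mu_0<\mu_1<\dots$ are called the Dirichlet eigenvalues. Let $M(\theta,\beta)$ be the bounded operator in $\ell^2(\mathbb Z^2)$ given by $$(M(\theta,\beta)g)_{m,n}=e^{i\pi n\theta}g_{m+1,n}+e^{-i\pi n\theta}g_{m-1,n}+\beta^2\big(e^{-i\pi m\theta}g_{m,n+1}+e^{i\pi m\theta}g_{m,n-1}\big).$$ For $z\in\mathbb C$ let $u_1(\cdot;z),u_2(\cdot;z)\in H^2[0,l]$ be the solutions of $-u''+Vu=zu$ with $u_1(0;z)=0$, $u_1'(0;z)=1$ and $u_2(0;z)=1$, $u_2'(0;z)=0$. Put $$\eta(z)=(1+\beta^2)\big(u_1'(l;z)+u_2(l;z)\big)+\alpha u_1(l;z),\qquad \Sigma=\{x\in\mathbb R:\eta(x)\in\operatorname{spec}M(\theta,\beta)\}.$$ A gap of a closed set $S\subseteq\mathbb R$ is a bounded connected component $(a,b)$ of $\mathbb R\setminus S$, with $a<b$ and $a,b\in S$. If $\theta$ is not an integer,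 then: 1. the spectrum of $\Lambda$ has infinitely many gaps; 2. every Dirichlet eigenvalue $\mu_k$ lies inside a gap $(a,b)$ of $\Sigma$, and $\mu_k$ is the only point of the spectrum of $\Lambda$ in $(a,b)$, that is, $(a,b)\cap\operatorname{spec}\Lambda=\{\mu_k\}$; 3. $\|M(\theta,\beta)\|<2(1+\beta^2)$, and $|\eta(\mu_k)|\ge2(1+\beta^2)$ for every $k$. -/

import Mathlib

open MeasureTheory Set

noncomputable section

namespace MagneticLattice

/-! ### Spectrum and eigenvalues of an unbounded operator -/

section Operators

variable {E : Type*} [NormedAddCommGroup E] [NormedSpace ℂ E]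

/-- `z` is in the resolvent set of `T`: the operator `T - z` is a bijection from `dom T` onto the
whole space with bounded inverse `R`. -/
def IsResolventPoint (T : E →ₗ.[ℂ] E) (z : ℂ) : Prop :=
  ∃ R : E →L[ℂ] E,
    (∀ g : E, ∃ h : R g ∈ T.domain, T ⟨R g, h⟩ - z • R g = g) ∧
    (∀ x : T.domain, R (T x - z • (x : E)) = x)

/-- The spectrum of `T` on the real axis (all of the spectrum if `T` is self-adjoint). -/
def realSpec (T : E →ₗ.[ℂ] E) : Set ℝ :=
  {x : ℝ | ¬ IsResolventPoint T (x : ℂ)}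

/-- `z` is an eigenvalue of `T`. -/
def IsEigenvalue (T : E →ₗ.[ℂ] E) (z : ℂ) : Prop :=
  ∃ x : T.domain, (x : E) ≠ 0 ∧ T x = z • (x : E)

end Operators

/-- `(a, b)` is a gap of the closed set `S ⊆ ℝ`: a bounded connected component of `ℝ \ S`. -/
def IsGap (S : Set ℝ) (a b : ℝ) : Prop :=
  a < b ∧ a ∈ S ∧ b ∈ S ∧ Disjoint (Ioo a b) S

/-! ### The Sobolev space `H²[0,l]` -/

/-- Lebesgue measure on `[0,l]`. -/
abbrev edgeMeasure (l : ℝ) : Measure ℝ := volume.restrict (Icc 0 l)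

/-- The space `L²[0,l]`. -/
abbrev EdgeL2 (l : ℝ) : Type := Lp ℂ 2 (edgeMeasure l)

/-- `u ∈ H²[0,l]` with derivatives `u' = v` and `u'' = w`: `w ∈ L²[0,l]`, and on `[0,l]` the
function `v` is a primitive of `w` and `u` is a primitive of `v`. -/
structure IsH2 (l : ℝ) (u v w : ℝ → ℂ) : Prop where
  memLp : MemLp w 2 (edgeMeasure l)
  deriv_eq : ∀ t ∈ Icc (0 : ℝ) l, v t = v 0 + ∫ s in (0 : ℝ)..t, w s
  fun_eq : ∀ t ∈ Icc (0 : ℝ) l, u t = u 0 + ∫ s in (0 : ℝ)..t, v s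

/-- `u ∈ H²[0,l]` (with `u' = v`, `u'' = w`) represents `f ∈ L²[0,l]`, and `-u'' + V u`
represents `g ∈ L²[0,l]`. -/
structure Represents (l : ℝ) (V : ℝ → ℝ) (f g : EdgeL2 l) (u v w : ℝ → ℂ) : Prop where
  isH2 : IsH2 l u v w
  left : f =ᵐ[edgeMeasure l] u
  right : g =ᵐ[edgeMeasure l] fun t => -w t + (V t : ℂ) * u t

/-! ### Closure of these notions under linear combinations, and uniqueness -/

section Helpers

variable {l : ℝ} {V : ℝ → ℝ}

lemma IsH2.intervalIntegrable_snd {u v w : ℝ → ℂ} (h : IsH2 l u v w) {t : ℝ}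
    (ht : t ∈ Icc (0 : ℝ) l) : IntervalIntegrable w volume 0 t := by
  have h1 : IntegrableOn w (Icc 0 l) := h.memLp.integrable (by norm_num)
  rw [intervalIntegrable_iff_integrableOn_Icc_of_le ht.1]
  exact h1.mono_set (Icc_subset_Icc_right ht.2)

lemma IsH2.continuousOn_fst {u v w : ℝ → ℂ} (h : IsH2 l u v w) :
    ContinuousOn v (Icc 0 l) := by
  rcases le_or_gt 0 l with hl | hl
  · have h1 : IntegrableOn w (uIcc 0 l) := by
      rw [uIcc_of_le hl]; exact h.memLp.integrable (by norm_num)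
    have h2 := intervalIntegral.continuousOn_primitive_interval h1
    rw [uIcc_of_le hl] at h2
    exact (continuousOn_const.add h2).congr h.deriv_eq
  · simp [Icc_eq_empty (not_le.mpr hl)]

lemma IsH2.intervalIntegrable_fst {u v w : ℝ → ℂ} (h : IsH2 l u v w) {t : ℝ}
    (ht : t ∈ Icc (0 : ℝ) l) : IntervalIntegrable v volume 0 t := by
  apply ContinuousOn.intervalIntegrable
  rw [uIcc_of_le ht.1]
  exact h.continuousOn_fst.mono (Icc_subset_Icc_right ht.2)

lemma IsH2.continuousOn {u v w : ℝ → ℂ} (h : IsH2 l u v w) :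
    ContinuousOn u (Icc 0 l) := by
  rcases le_or_gt 0 l with hl | hl
  · have h1 : IntegrableOn v (uIcc 0 l) := by
      rw [uIcc_of_le hl]; exact h.continuousOn_fst.integrableOn_compact isCompact_Icc
    have h2 := intervalIntegral.continuousOn_primitive_interval h1
    rw [uIcc_of_le hl] at h2
    exact (continuousOn_const.add h2).congr h.fun_eq
  · simp [Icc_eq_empty (not_le.mpr hl)]

lemma IsH2.add {u v w u' v' w' : ℝ → ℂ} (h : IsH2 l u v w) (h' : IsH2 l u' v' w') :
    IsH2 l (u + u') (v + v') (w + w') where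
  memLp := h.memLp.add h'.memLp
  deriv_eq t ht := by
    have := intervalIntegral.integral_add (h.intervalIntegrable_snd ht)
      (h'.intervalIntegrable_snd ht)
    simp only [Pi.add_apply, this, h.deriv_eq t ht, h'.deriv_eq t ht]
    ring
  fun_eq t ht := by
    have := intervalIntegral.integral_add (h.intervalIntegrable_fst ht)
      (h'.intervalIntegrable_fst ht)
    simp only [Pi.add_apply, this, h.fun_eq t ht, h'.fun_eq t ht]
    ring

lemma IsH2.smul {u v w : ℝ → ℂ} (c : ℂ) (h : IsH2 l u v w) :
    IsH2 l (c • u) (c • v) (c • w) where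
  memLp := h.memLp.const_smul c
  deriv_eq t ht := by
    simp only [Pi.smul_apply, intervalIntegral.integral_smul, h.deriv_eq t ht, smul_add]
  fun_eq t ht := by
    simp only [Pi.smul_apply, intervalIntegral.integral_smul, h.fun_eq t ht, smul_add]

lemma IsH2.zero : IsH2 l 0 0 0 where
  memLp := MemLp.zero
  deriv_eq t _ := by simp
  fun_eq t _ := by simp

lemma Represents.add {f g f' g' : EdgeL2 l} {u v w u' v' w' : ℝ → ℂ}
    (h : Represents l V f g u v w) (h' : Represents l V f' g' u' v' w') :
    Represents l V (f + f') (g + g') (u + u') (v + v') (w + w') where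
  isH2 := h.isH2.add h'.isH2
  left := by
    filter_upwards [Lp.coeFn_add f f', h.left, h'.left] with t h1 h2 h3
    rw [h1, Pi.add_apply, Pi.add_apply, h2, h3]
  right := by
    filter_upwards [Lp.coeFn_add g g', h.right, h'.right] with t h1 h2 h3
    simp only [h1, Pi.add_apply, h2, h3]
    ring

lemma Represents.smul {f g : EdgeL2 l} {u v w : ℝ → ℂ} (c : ℂ)
    (h : Represents l V f g u v w) :
    Represents l V (c • f) (c • g) (c • u) (c • v) (c • w) where
  isH2 := h.isH2.smul c
  left := by
    filter_upwards [Lp.coeFn_smul c f, h.left] with t h1 h2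
    simp [h1, h2]
  right := by
    filter_upwards [Lp.coeFn_smul c g, h.right] with t h1 h2
    simp only [h1, Pi.smul_apply, h2, smul_eq_mul]
    ring

lemma Represents.zero : Represents l V 0 0 0 0 0 where
  isH2 := IsH2.zero
  left := Lp.coeFn_zero _ _ _
  right := by
    filter_upwards [Lp.coeFn_zero ℂ 2 (edgeMeasure l)] with t h1
    rw [h1]
    simp

/-- An integrable function with vanishing primitive vanishes almost everywhere. -/
lemma ae_eq_zero_of_primitive {w : ℝ → ℂ} (hl : 0 < l) (hw : IntegrableOn w (Icc 0 l))
    (h : ∀ t ∈ Icc (0 : ℝ) l, ∫ s in (0 : ℝ)..t, w s = 0) : w =ᵐ[edgeMeasure l] 0 := by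
  have hi : IntervalIntegrable w volume 0 l :=
    (intervalIntegrable_iff_integrableOn_Icc_of_le hl.le).2 hw
  have h1 := hi.ae_hasDerivAt_integral
  have h2 : ∀ᵐ x : ℝ, x ≠ 0 := by simp [ae_iff]
  have h3 : ∀ᵐ x : ℝ, x ≠ l := by simp [ae_iff]
  rw [Filter.EventuallyEq, ae_restrict_iff' measurableSet_Icc]
  filter_upwards [h1, h2, h3] with x hx hx0 hxl hxI
  have hd := hx (by rwa [uIcc_of_le hl.le]) 0 (by simp)
  have hz : (fun y => ∫ s in (0 : ℝ)..y, w s) =ᶠ[nhds x] fun _ => 0 := by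
    filter_upwards [Ioo_mem_nhds (lt_of_le_of_ne hxI.1 (Ne.symm hx0))
      (lt_of_le_of_ne hxI.2 hxl)] with y hy
    exact h y ⟨hy.1.le, hy.2.le⟩
  exact hd.unique ((hasDerivAt_const x (0 : ℂ)).congr_of_eventuallyEq hz)

/-- A continuous function on `[0,l]` which vanishes almost everywhere vanishes. -/
lemma eq_zero_of_ae {u : ℝ → ℂ} (hl : 0 < l) (hc : ContinuousOn u (Icc 0 l))
    (h : u =ᵐ[edgeMeasure l] 0) : ∀ t ∈ Icc (0 : ℝ) l, u t = 0 :=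
  Measure.eqOn_Icc_of_ae_eq volume hl.ne h hc continuousOn_const

/-- The element represented by `-u'' + V u` is determined by the element represented by `u`. -/
lemma Represents.snd_eq_zero {f g : EdgeL2 l} {u v w : ℝ → ℂ} (hl : 0 < l)
    (h : Represents l V f g u v w) (hf : f = 0) : g = 0 := by
  have hu : ∀ t ∈ Icc (0 : ℝ) l, u t = 0 := by
    refine eq_zero_of_ae hl h.isH2.continuousOn ?_
    subst hf
    exact h.left.symm.trans (Lp.coeFn_zero _ _ _)
  have h0 : (0 : ℝ) ∈ Icc (0 : ℝ) l := ⟨le_rfl, hl.le⟩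
  have hv : ∀ t ∈ Icc (0 : ℝ) l, v t = 0 := by
    refine eq_zero_of_ae hl h.isH2.continuousOn_fst (ae_eq_zero_of_primitive hl
      (h.isH2.continuousOn_fst.integrableOn_compact isCompact_Icc) fun t ht => ?_)
    have := h.isH2.fun_eq t ht
    rw [hu t ht, hu 0 h0] at this
    simpa using this.symm
  have hw : w =ᵐ[edgeMeasure l] 0 := by
    refine ae_eq_zero_of_primitive hl (h.isH2.memLp.integrable (by norm_num)) fun t ht => ?_
    have := h.isH2.deriv_eq t ht
    rw [hv t ht, hv 0 h0] at this
    simpa using this.symm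
  rw [Lp.eq_zero_iff_ae_eq_zero]
  filter_upwards [h.right, hw, ae_restrict_mem measurableSet_Icc] with t h1 h2 h3
  simp [h1, h2, hu t h3]

end Helpers

/-! ### The Dirichlet operator on one edge -/

/-- The graph of `D f = -f'' + V f`, `dom D = {f ∈ H²[0,l] : f(0) = f(l) = 0}`. -/
def dirichletGraph (l : ℝ) (V : ℝ → ℝ) : Submodule ℂ (EdgeL2 l × EdgeL2 l) where
  carrier := {p | ∃ u v w : ℝ → ℂ, Represents l V p.1 p.2 u v w ∧ u 0 = 0 ∧ u l = 0}
  add_mem' := by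
    rintro p q ⟨u, v, w, h, h0, h1⟩ ⟨u', v', w', h', h0', h1'⟩
    exact ⟨_, _, _, h.add h', by simp [h0, h0'], by simp [h1, h1']⟩
  zero_mem' := ⟨0, 0, 0, Represents.zero, rfl, rfl⟩
  smul_mem' := by
    rintro c p ⟨u, v, w, h, h0, h1⟩
    exact ⟨_, _, _, h.smul c, by simp [h0], by simp [h1]⟩

/-- The Dirichlet operator `D` on `L²[0,l]`. -/
def dirichletOp (l : ℝ) (V : ℝ → ℝ) : EdgeL2 l →ₗ.[ℂ] EdgeL2 l :=
  (dirichletGraph l V).toLinearPMap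

/-- `dirichletGraph` really is the graph of the operator. -/
theorem dirichletOp_graph {l : ℝ} (hl : 0 < l) (V : ℝ → ℝ) :
    (dirichletOp l V).graph = dirichletGraph l V := by
  refine Submodule.toLinearPMap_graph_eq _ ?_
  rintro ⟨f, g⟩ ⟨u, v, w, h, -, -⟩ hf
  exact h.snd_eq_zero hl hf

/-! ### The operator `Λ` on the square lattice -/

/-- The orientation of an edge: `r` (right) or `u` (up). -/
inductive Dir
  | r
  | u

/-- The edge `(m, n, r)` joins the nodes `(m, n)` and `(m + 1, n)`; the edge `(m, n, u)` joins
`(m, n)` and `(m, n + 1)`. The point `0` of the edge is the node `(m, n)`. -/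
abbrev Edge : Type := ℤ × ℤ × Dir

/-- The Hilbert space of the lattice: the `ℓ²`-direct sum over all edges of `L²[0,l]`. -/
abbrev LatticeL2 (l : ℝ) : Type := lp (fun _ : Edge => EdgeL2 l) 2

/-- The phase `e^{iπx}`. -/
def phase (x : ℝ) : ℂ := Complex.exp (Complex.I * Real.pi * x)

/-- The four boundary values at the node `(m, n)`, brought together by the phases, are given by
the single number `c`. -/
def VertexValue (l θ β : ℝ) (u : Edge → ℝ → ℂ) (m n : ℤ) (c : ℂ) : Prop :=
  u (m, n, Dir.r) 0 = c ∧
  1 / (β : ℂ) * u (m, n, Dir.u) 0 = c ∧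
  phase (-(n * θ)) * u (m - 1, n, Dir.r) l = c ∧
  1 / (β : ℂ) * (phase (m * θ) * u (m, n - 1, Dir.u) l) = c

/-- The weighted sum of the derivatives at the node `(m, n)`. -/
def vertexDeriv (l θ β : ℝ) (v : Edge → ℝ → ℂ) (m n : ℤ) : ℂ :=
  v (m, n, Dir.r) 0 + (β : ℂ) * v (m, n, Dir.u) 0
    - phase (-(n * θ)) * v (m - 1, n, Dir.r) l
    - (β : ℂ) * phase (m * θ) * v (m, n - 1, Dir.u) l

/-- The graph of `Λ`: it acts on each edge as `φ ↦ -φ'' + V φ`, on those `φ` which are `H²` on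
each edge, satisfy the magnetic `δ`-type conditions at all nodes, and have image in the Hilbert
space. -/
def latticeGraph (l : ℝ) (V : ℝ → ℝ) (α β θ : ℝ) :
    Submodule ℂ (LatticeL2 l × LatticeL2 l) where
  carrier := {p | ∃ u v w : Edge → ℝ → ℂ,
    (∀ e, Represents l V (p.1 e) (p.2 e) (u e) (v e) (w e)) ∧
    ∀ m n : ℤ, ∃ c : ℂ, VertexValue l θ β u m n c ∧ vertexDeriv l θ β v m n = α * c}
  add_mem' := by
    rintro p q ⟨u, v, w, h, hb⟩ ⟨u', v', w', h', hb'⟩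
    refine ⟨fun e => u e + u' e, fun e => v e + v' e, fun e => w e + w' e,
      fun e => (h e).add (h' e), fun m n => ?_⟩
    obtain ⟨c, ⟨h1, h2, h3, h4⟩, h5⟩ := hb m n
    obtain ⟨c', ⟨h1', h2', h3', h4'⟩, h5'⟩ := hb' m n
    refine ⟨c + c', ⟨?_, ?_, ?_, ?_⟩, ?_⟩
    · simp only [Pi.add_apply, h1, h1']
    · rw [← h2, ← h2']; simp only [Pi.add_apply]; ring
    · rw [← h3, ← h3']; simp only [Pi.add_apply]; ring
    · rw [← h4, ← h4']; simp only [Pi.add_apply]; ring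
    · rw [mul_add, ← h5, ← h5']; simp only [vertexDeriv, Pi.add_apply]; ring
  zero_mem' := ⟨fun _ => 0, fun _ => 0, fun _ => 0, fun _ => Represents.zero,
    fun m n => ⟨0, by simp [VertexValue], by simp [vertexDeriv]⟩⟩
  smul_mem' := by
    rintro a p ⟨u, v, w, h, hb⟩
    refine ⟨fun e => a • u e, fun e => a • v e, fun e => a • w e,
      fun e => (h e).smul a, fun m n => ?_⟩
    obtain ⟨c, ⟨h1, h2, h3, h4⟩, h5⟩ := hb m n
    refine ⟨a * c, ⟨?_, ?_, ?_, ?_⟩, ?_⟩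
    · simp only [Pi.smul_apply, h1, smul_eq_mul]
    · rw [← h2]; simp only [Pi.smul_apply, smul_eq_mul]; ring
    · rw [← h3]; simp only [Pi.smul_apply, smul_eq_mul]; ring
    · rw [← h4]; simp only [Pi.smul_apply, smul_eq_mul]; ring
    · rw [mul_left_comm, ← h5]; simp only [vertexDeriv, Pi.smul_apply, smul_eq_mul]; ring

/-- The magnetic Schrödinger operator `Λ` on the square lattice. -/
def latticeOp (l : ℝ) (V : ℝ → ℝ) (α β θ : ℝ) : LatticeL2 l →ₗ.[ℂ] LatticeL2 l :=
  (latticeGraph l V α β θ).toLinearPMap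

/-- `latticeGraph` really is the graph of the operator. -/
theorem latticeOp_graph {l : ℝ} (hl : 0 < l) (V : ℝ → ℝ) (α β θ : ℝ) :
    (latticeOp l V α β θ).graph = latticeGraph l V α β θ := by
  refine Submodule.toLinearPMap_graph_eq _ ?_
  rintro ⟨f, g⟩ ⟨u, v, w, h, -⟩ hf
  ext1
  funext e
  refine (h e).snd_eq_zero hl ?_
  have hf' : f = 0 := hf
  simp [hf']

/-! ### The discrete magnetic Laplacian -/

/-- The Hilbert space `ℓ²(ℤ²)`. -/
abbrev NodeL2 : Type := lp (fun _ : ℤ × ℤ => ℂ) 2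

lemma phase_norm (x : ℝ) : ‖phase x‖ = 1 := by
  have : Complex.I * Real.pi * x = ((Real.pi * x : ℝ) : ℂ) * Complex.I := by push_cast; ring
  rw [phase, this, Complex.norm_exp_ofReal_mul_I]

lemma shift_summable (σ : ℤ × ℤ ≃ ℤ × ℤ) (x : ℤ × ℤ → ℝ) (g : NodeL2) :
    Summable fun i => ‖phase (x i) * g (σ i)‖ ^ (2 : ENNReal).toReal := by
  have h := (memℓp_gen_iff (p := 2) (by norm_num)).1 (lp.memℓp g)
  simp only [norm_mul, phase_norm, one_mul]
  exact σ.summable_iff.2 h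

/-- The magnetic shift `(g i)_i ↦ (e^{iπ x i} g (σ i))_i` on `ℓ²(ℤ²)`. -/
def magneticShift (σ : ℤ × ℤ ≃ ℤ × ℤ) (x : ℤ × ℤ → ℝ) : NodeL2 →L[ℂ] NodeL2 :=
  LinearMap.mkContinuous
    { toFun := fun g => ⟨fun i => phase (x i) * g (σ i),
        (memℓp_gen_iff (p := 2) (by norm_num)).2 (shift_summable σ x g)⟩
      map_add' := fun g h => by ext i; exact mul_add _ _ _
      map_smul' := fun c g => by ext i; exact mul_left_comm _ _ _ }
    1 (fun g => by
      rw [one_mul]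
      refine le_of_eq ?_
      rw [lp.norm_eq_tsum_rpow (by norm_num), lp.norm_eq_tsum_rpow (by norm_num)]
      congr 1
      rw [← σ.tsum_eq fun i => ‖g i‖ ^ (2 : ENNReal).toReal]
      simp [phase_norm])

/-- Translation of `ℤ²` by `(j, k)`. -/
def translate (j k : ℤ) : ℤ × ℤ ≃ ℤ × ℤ := Equiv.addRight (j, k)

/-- The discrete magnetic Laplacian `M(θ,β)`. -/
def discreteLaplacian (θ β : ℝ) : NodeL2 →L[ℂ] NodeL2 :=
  magneticShift (translate 1 0) (fun i => i.2 * θ)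
    + magneticShift (translate (-1) 0) (fun i => -(i.2 * θ))
    + ((β : ℂ) ^ 2) • (magneticShift (translate 0 1) (fun i => -(i.1 * θ))
      + magneticShift (translate 0 (-1)) (fun i => i.1 * θ))

theorem discreteLaplacian_apply (θ β : ℝ) (g : NodeL2) (m n : ℤ) :
    discreteLaplacian θ β g (m, n) =
      phase (n * θ) * g (m + 1, n) + phase (-(n * θ)) * g (m - 1, n)
      + (β : ℂ) ^ 2 * (phase (-(m * θ)) * g (m, n + 1) + phase (m * θ) * g (m, n - 1)) := by
  have h : ∀ (j k : ℤ) (x : ℤ × ℤ → ℝ), magneticShift (translate j k) x g (m, n) =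
      phase (x (m, n)) * g (m + j, n + k) := fun _ _ _ => rfl
  have e : discreteLaplacian θ β g (m, n) =
      magneticShift (translate 1 0) (fun i => i.2 * θ) g (m, n)
      + magneticShift (translate (-1) 0) (fun i => -(i.2 * θ)) g (m, n)
      + (β : ℂ) ^ 2 * (magneticShift (translate 0 1) (fun i => -(i.1 * θ)) g (m, n)
        + magneticShift (translate 0 (-1)) (fun i => i.1 * θ) g (m, n)) := rfl
  simp only [e, h, add_zero, sub_eq_add_neg]

/-! ### The discriminant `η` and the set `Σ` -/

/-- `u ∈ H²[0,l]`, with `u' = v`, solves `-u'' + V u = z u`, `u(0) = a`, `u'(0) = b`. -/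
def IsSolution (l : ℝ) (V : ℝ → ℝ) (z a b : ℂ) (u v : ℝ → ℂ) : Prop :=
  ∃ w : ℝ → ℂ, IsH2 l u v w ∧
    (∀ᵐ t ∂(edgeMeasure l), -w t + (V t : ℂ) * u t = z * u t) ∧ u 0 = a ∧ v 0 = b

/-- `y = η(z) = (1 + β²)(u₁'(l;z) + u₂(l;z)) + α u₁(l;z)`, where `u₁, u₂` solve
`-u'' + V u = z u` with `u₁(0) = 0, u₁'(0) = 1` and `u₂(0) = 1, u₂'(0) = 0`. -/
def IsEta (l : ℝ) (V : ℝ → ℝ) (α β : ℝ) (z y : ℂ) : Prop :=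
  ∃ u₁ v₁ u₂ v₂ : ℝ → ℂ, IsSolution l V z 0 1 u₁ v₁ ∧ IsSolution l V z 1 0 u₂ v₂ ∧
    y = (1 + (β : ℂ) ^ 2) * (v₁ l + u₂ l) + α * u₁ l

/-- The part `Σ = η⁻¹(spec M(θ,β))` of the spectrum of `Λ`. -/
def bandSet (l : ℝ) (V : ℝ → ℝ) (α β θ : ℝ) : Set ℝ :=
  {x : ℝ | ∃ y : ℂ, IsEta l V α β x y ∧ y ∈ spectrum ℂ (discreteLaplacian θ β)}

end MagneticLattice

end

/-!
Write `u₁`, `u₂`, `M`, `η` as in the statement. If `u₁(l; x) ≠ 0`, a function on the graph solving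
`-φ'' + Vφ = xφ + k` is determined by its node values `g`, through the Dirichlet problem on each
edge, and the vertex conditions become `(M - η(x)) g = G` with `G` depending linearly on `k`; so `x`
is in the resolvent set if moreover `η(x) ∉ spec M`. If `u₁(l; x) = 0`, the values at the two ends
of an edge carrying no source are proportional. With a source on a single edge, going around the
plaquettes not containing that edge, each with flux `2πθ ∉ 2πℤ`, forces the node values at both its
ends to vanish, which is impossible for a general source: `x` belongs to the spectrum.

At a zero `μ` of `x ↦ u₁(l; x)` the Wronskian is `u₂(l; μ) u₁'(l; μ) = 1`, hence
`|η(μ)| ≥ 2(1 + β²)` by AM-GM, with the sign of `u₁'(l; μ)`, while `‖M‖ < 2(1 + β²)` because the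
magnetic translations in the two directions do not commute. By Lagrange's identity `∂ₓu₁(l; μ)` has
the sign of `u₁'(l; μ)`, so the signs of `η` alternate along consecutive zeros; between any two of
them `η` takes every value of `spec M`, so that a point of `Σ` separates them. Below the first zero
this follows from `η(x) → ∞` as `x → -∞`, and `u₁(l; k²) ≈ sin (k l) / k` provides infinitely many
zeros.
-/

noncomputable section

namespace MagneticLattice

/-! ### Primitives on `[0,l]` -/

section Primitive

variable {𝕜 : Type*} [RCLike 𝕜] {l : ℝ} {f f' g g' : ℝ → 𝕜}

/-- `f` is absolutely continuous on `[0,l]` with derivative `f'`, expressed by the fundamental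
theorem of calculus; `0 ≤ l` is part of the notion. -/
structure IsPrimitive (l : ℝ) (f f' : ℝ → 𝕜) : Prop where
  nonneg : 0 ≤ l
  integrableOn : IntegrableOn f' (Icc 0 l)
  eq : ∀ t ∈ Icc (0 : ℝ) l, f t = f 0 + ∫ s in (0 : ℝ)..t, f' s

lemma IsPrimitive.intervalIntegrable (h : IsPrimitive l f f') {t : ℝ} (ht : t ∈ Icc (0 : ℝ) l) :
    IntervalIntegrable f' volume 0 t := by
  rw [intervalIntegrable_iff_integrableOn_Icc_of_le ht.1]
  exact h.integrableOn.mono_set (Icc_subset_Icc_right ht.2)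

lemma IsPrimitive.continuousOn (h : IsPrimitive l f f') : ContinuousOn f (Icc 0 l) := by
  have hint : IntegrableOn f' (uIcc 0 l) := by
    rw [uIcc_of_le h.nonneg]
    exact h.integrableOn
  have hcont := intervalIntegral.continuousOn_primitive_interval hint
  rw [uIcc_of_le h.nonneg] at hcont
  exact (continuousOn_const.add hcont).congr h.eq

lemma IsPrimitive.add (hf : IsPrimitive l f f') (hg : IsPrimitive l g g') :
    IsPrimitive l (fun t => f t + g t) (fun t => f' t + g' t) where
  nonneg := hf.nonneg
  integrableOn := hf.integrableOn.add hg.integrableOn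
  eq t ht := by
    rw [intervalIntegral.integral_add (hf.intervalIntegrable ht) (hg.intervalIntegrable ht),
      hf.eq t ht, hg.eq t ht]
    ring

lemma IsPrimitive.const_mul (a : 𝕜) (hf : IsPrimitive l f f') :
    IsPrimitive l (fun t => a * f t) (fun t => a * f' t) where
  nonneg := hf.nonneg
  integrableOn := hf.integrableOn.const_mul a
  eq t ht := by
    rw [intervalIntegral.integral_const_mul, hf.eq t ht]
    ring

lemma IsPrimitive.sub (hf : IsPrimitive l f f') (hg : IsPrimitive l g g') :
    IsPrimitive l (fun t => f t - g t) (fun t => f' t - g' t) := by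
  simpa [sub_eq_add_neg] using hf.add (hg.const_mul (-1))

lemma IsPrimitive.congr_ae (hf : IsPrimitive l f f') (h : f' =ᵐ[edgeMeasure l] g') :
    IsPrimitive l f g' where
  nonneg := hf.nonneg
  integrableOn := hf.integrableOn.congr h
  eq t ht := by
    rw [hf.eq t ht]
    congr 1
    apply intervalIntegral.integral_congr_ae
    rw [Filter.EventuallyEq, ae_restrict_iff' measurableSet_Icc] at h
    filter_upwards [h] with s hs hst
    rw [uIoc_of_le ht.1] at hst
    exact hs ⟨hst.1.le, hst.2.trans ht.2⟩

lemma IsPrimitive.congr (hf : IsPrimitive l f f') (h : ∀ t ∈ Icc (0 : ℝ) l, f' t = g' t) :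
    IsPrimitive l f g' :=
  hf.congr_ae ((ae_restrict_mem measurableSet_Icc).mono h)

lemma isPrimitive_integral (hl : 0 ≤ l) (h : IntegrableOn f' (Icc 0 l)) (a : 𝕜) :
    IsPrimitive l (fun t => a + ∫ s in (0 : ℝ)..t, f' s) f' where
  nonneg := hl
  integrableOn := h
  eq t _ := by simp

lemma isPrimitive_of_hasDerivAt (hl : 0 ≤ l) (hd : ∀ t, HasDerivAt f (f' t) t)
    (hc : Continuous f') : IsPrimitive l f f' where
  nonneg := hl
  integrableOn := hc.continuousOn.integrableOn_compact isCompact_Icc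
  eq t _ := by
    rw [intervalIntegral.integral_eq_sub_of_hasDerivAt (fun s _ => hd s)
      (hc.intervalIntegrable _ _)]
    ring

lemma IsPrimitive.ofReal {f f' : ℝ → ℝ} (h : IsPrimitive l f f') :
    IsPrimitive l (fun t => (f t : ℂ)) (fun t => (f' t : ℂ)) where
  nonneg := h.nonneg
  integrableOn := h.integrableOn.ofReal
  eq t ht := by
    rw [intervalIntegral.integral_ofReal, h.eq t ht]
    push_cast
    rfl

-- The increments of `f` are dominated by those of `t ↦ ∫ ‖f'‖` on `[0,t]`.
lemma IsPrimitive.absolutelyContinuousOnInterval (h : IsPrimitive l f f') :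
    AbsolutelyContinuousOnInterval f 0 l := by
  have hint := h.intervalIntegrable ⟨h.nonneg, le_rfl⟩
  have hsub {x : ℝ} (hx : x ∈ uIcc 0 l) : IntervalIntegrable f' volume 0 x :=
    hint.mono_set (uIcc_subset_uIcc_left hx)
  have hdist {x y : ℝ} (hx : x ∈ uIcc 0 l) (hy : y ∈ uIcc 0 l) :
      dist (f x) (f y) ≤ dist (∫ s in (0 : ℝ)..x, ‖f' s‖) (∫ s in (0 : ℝ)..y, ‖f' s‖) := by
    rw [h.eq x (uIcc_of_le h.nonneg ▸ hx), h.eq y (uIcc_of_le h.nonneg ▸ hy), dist_add_left,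
      dist_eq_norm, dist_eq_norm, Real.norm_eq_abs,
      intervalIntegral.integral_interval_sub_left (hsub hx) (hsub hy),
      intervalIntegral.integral_interval_sub_left (hsub hx).norm (hsub hy).norm]
    exact intervalIntegral.norm_integral_le_abs_integral_norm
  refine squeeze_zero' (.of_forall fun E => Finset.sum_nonneg fun _ _ => dist_nonneg) ?_
    (hint.norm.absolutelyContinuousOnInterval_intervalIntegral (c := 0) (by simp))
  filter_upwards [Filter.eventually_inf_principal.2 (.of_forall fun _ hE => hE)] with E hE
  exact Finset.sum_le_sum fun i hi => hdist (hE.1 i hi).1 (hE.1 i hi).2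

lemma IsPrimitive.ae_hasDerivAt (h : IsPrimitive l f f') :
    ∀ᵐ x, x ∈ uIcc 0 l → HasDerivAt f (f' x) x := by
  have hne (a : ℝ) : ∀ᵐ x : ℝ, x ≠ a := by simp [ae_iff]
  filter_upwards [(h.intervalIntegrable ⟨h.nonneg, le_rfl⟩).ae_hasDerivAt_integral, hne 0, hne l]
    with x hx hx0 hxl hmem
  refine ((hx hmem 0 (by simp)).const_add (f 0)).congr_of_eventuallyEq ?_
  rw [uIcc_of_le h.nonneg] at hmem
  filter_upwards [Ioo_mem_nhds (hmem.1.lt_of_ne' hx0) (hmem.2.lt_of_ne hxl)] with y hy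
  exact h.eq y ⟨hy.1.le, hy.2.le⟩

lemma isPrimitive_of_ae_hasDerivAt (hl : 0 ≤ l) (hf : AbsolutelyContinuousOnInterval f 0 l)
    (hf' : IntegrableOn f' (Icc 0 l)) (hd : ∀ᵐ x, x ∈ uIcc 0 l → HasDerivAt f (f' x) x) :
    IsPrimitive l f f' := by
  have hP := isPrimitive_integral hl hf' 0
  obtain ⟨C, hC⟩ := (hf.sub hP.absolutelyContinuousOnInterval).const_of_ae_hasDerivAt_zero (by
    filter_upwards [hd, hP.ae_hasDerivAt] with x hx hPx hmem
    simpa using (hx hmem).sub (hPx hmem))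
  rw [uIcc_of_le hl] at hC
  refine ⟨hl, hf', fun t ht => ?_⟩
  have hsub := (hC t ht).trans (hC 0 ⟨le_rfl, hl⟩).symm
  simp only [Pi.sub_apply, intervalIntegral.integral_same, zero_add, sub_zero] at hsub
  linear_combination hsub

lemma IsPrimitive.mul (hf : IsPrimitive l f f') (hg : IsPrimitive l g g') :
    IsPrimitive l (fun t => f t * g t) (fun t => f' t * g t + f t * g' t) := by
  refine isPrimitive_of_ae_hasDerivAt hf.nonneg
    (hf.absolutelyContinuousOnInterval.smul hg.absolutelyContinuousOnInterval)
    ((hf.integrableOn.mul_continuousOn hg.continuousOn isCompact_Icc).add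
      (hg.integrableOn.continuousOn_mul hf.continuousOn isCompact_Icc)) ?_
  filter_upwards [hf.ae_hasDerivAt, hg.ae_hasDerivAt] with x hfx hgx hx
  exact (hfx hx).mul (hgx hx)

end Primitive

/-! ### The equation `-u'' + q u = f` on `[0,l]` -/

section Equation

variable {𝕜 : Type*} [RCLike 𝕜] {l : ℝ}

/-- On `[0,l]`, the pair `(u, v)` satisfies `u' = v` and `-v' + q u = f`: the equation
`-u'' + q u = f` written as a first order system. -/
structure IsSol (l : ℝ) (q f u v : ℝ → 𝕜) : Prop where
  fst : IsPrimitive l u v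
  snd : IsPrimitive l v (fun t => q t * u t - f t)

/-- The pairs `(c, c')` and `(s, s')` are the solutions of `-u'' + q u = 0` with
`c(0) = 1, c'(0) = 0` and `s(0) = 0, s'(0) = 1`. -/
structure IsFundamental (l : ℝ) (q c c' s s' : ℝ → 𝕜) : Prop where
  cos : IsSol l q (fun _ => 0) c c'
  sin : IsSol l q (fun _ => 0) s s'
  cos_zero : c 0 = 1
  cos_deriv_zero : c' 0 = 0
  sin_zero : s 0 = 0
  sin_deriv_zero : s' 0 = 1

variable {q f g u v p r c c' s s' : ℝ → 𝕜} {t : ℝ}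

lemma IsSol.congr_ae (h : IsSol l q f u v) {q₁ f₁ : ℝ → 𝕜}
    (hq : ∀ᵐ t ∂(edgeMeasure l), q t * u t - f t = q₁ t * u t - f₁ t) : IsSol l q₁ f₁ u v :=
  ⟨h.fst, h.snd.congr_ae hq⟩

lemma IsSol.add (h : IsSol l q f u v) (h' : IsSol l q g p r) :
    IsSol l q (fun t => f t + g t) (fun t => u t + p t) (fun t => v t + r t) :=
  ⟨h.fst.add h'.fst, (h.snd.add h'.snd).congr fun t _ => by ring⟩

lemma IsSol.const_mul (a : 𝕜) (h : IsSol l q f u v) :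
    IsSol l q (fun t => a * f t) (fun t => a * u t) (fun t => a * v t) :=
  ⟨h.fst.const_mul a, (h.snd.const_mul a).congr fun t _ => by ring⟩

lemma IsSol.ofReal {q f u v : ℝ → ℝ} (h : IsSol l q f u v) :
    IsSol l (fun t => (q t : ℂ)) (fun t => (f t : ℂ)) (fun t => (u t : ℂ)) (fun t => (v t : ℂ)) :=
  ⟨h.fst.ofReal, h.snd.ofReal.congr fun t _ => by push_cast; ring⟩

lemma IsSol.lagrange (h : IsSol l q f u v) (h' : IsSol l q g p r) (ht : t ∈ Icc (0 : ℝ) l) :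
    u t * r t - v t * p t =
      u 0 * r 0 - v 0 * p 0 + ∫ x in (0 : ℝ)..t, (f x * p x - u x * g x) :=
  (((h.fst.mul h'.snd).sub (h.snd.mul h'.fst)).congr (g' := fun x => f x * p x - u x * g x)
    fun x _ => by ring).eq t ht

namespace IsFundamental

lemma nonneg (h : IsFundamental l q c c' s s') : 0 ≤ l := h.cos.fst.nonneg

lemma ofReal {q c c' s s' : ℝ → ℝ} (h : IsFundamental l q c c' s s') :
    IsFundamental l (fun t => (q t : ℂ)) (fun t => (c t : ℂ)) (fun t => (c' t : ℂ))
      (fun t => (s t : ℂ)) (fun t => (s' t : ℂ)) where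
  cos := by simpa using h.cos.ofReal
  sin := by simpa using h.sin.ofReal
  cos_zero := by simp [h.cos_zero]
  cos_deriv_zero := by simp [h.cos_deriv_zero]
  sin_zero := by simp [h.sin_zero]
  sin_deriv_zero := by simp [h.sin_deriv_zero]

lemma wronskian (h : IsFundamental l q c c' s s') (ht : t ∈ Icc (0 : ℝ) l) :
    c t * s' t - c' t * s t = 1 := by
  simpa [h.cos_zero, h.cos_deriv_zero, h.sin_zero, h.sin_deriv_zero] using
    h.cos.lagrange h.sin ht

-- Variation of constants: solve Lagrange's identity with `s` and with `c` for `u` and `v`.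
lemma eq_fst_and_eq_snd (h : IsFundamental l q c c' s s') (hu : IsSol l q f u v)
    (ht : t ∈ Icc (0 : ℝ) l) :
    u t = u 0 * c t + v 0 * s t + (c t * ∫ x in (0 : ℝ)..t, f x * s x)
      - s t * ∫ x in (0 : ℝ)..t, f x * c x ∧
    v t = u 0 * c' t + v 0 * s' t + (c' t * ∫ x in (0 : ℝ)..t, f x * s x)
      - s' t * ∫ x in (0 : ℝ)..t, f x * c x := by
  have hsin := hu.lagrange h.sin ht
  have hcos := hu.lagrange h.cos ht
  have hw := h.wronskian ht
  simp only [h.cos_zero, h.cos_deriv_zero, h.sin_zero, h.sin_deriv_zero, mul_zero, sub_zero,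
    mul_one, zero_sub] at hsin hcos
  constructor
  · linear_combination c t * hsin - s t * hcos - u t * hw
  · linear_combination c' t * hsin - s' t * hcos - v t * hw

lemma eq_of_homogeneous (h : IsFundamental l q c c' s s') (hu : IsSol l q (fun _ => 0) u v)
    (ht : t ∈ Icc (0 : ℝ) l) :
    u t = u 0 * c t + v 0 * s t ∧ v t = u 0 * c' t + v 0 * s' t := by
  simpa using h.eq_fst_and_eq_snd hu ht

lemma isSol_particular (h : IsFundamental l q c c' s s') (hf : IntegrableOn f (Icc 0 l)) :
    IsSol l q f
      (fun t => (c t * ∫ x in (0 : ℝ)..t, f x * s x) - s t * ∫ x in (0 : ℝ)..t, f x * c x)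
      (fun t => (c' t * ∫ x in (0 : ℝ)..t, f x * s x) - s' t * ∫ x in (0 : ℝ)..t, f x * c x) := by
  have hs := isPrimitive_integral h.nonneg
    (hf.mul_continuousOn h.sin.fst.continuousOn isCompact_Icc) 0
  have hc := isPrimitive_integral h.nonneg
    (hf.mul_continuousOn h.cos.fst.continuousOn isCompact_Icc) 0
  simp only [zero_add] at hs hc
  refine ⟨((h.cos.fst.mul hs).sub (h.sin.fst.mul hc)).congr fun t _ => by ring,
    ((h.cos.snd.mul hs).sub (h.sin.snd.mul hc)).congr fun t ht => ?_⟩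
  linear_combination (-f t) * h.wronskian ht

end IsFundamental

end Equation

/-! ### Existence of solutions -/

section Existence

variable {𝕜 : Type*} [RCLike 𝕜] {l : ℝ}

lemma norm_volterra_le {k p u : ℝ → 𝕜} {A N κ t : ℝ} (hA : 0 ≤ A) (hN : 0 ≤ N)
    (hp : IntegrableOn p (Icc 0 l)) (hu : ∀ r ∈ Icc (0 : ℝ) l, ‖u r‖ ≤ N * Real.exp (κ * r))
    (ht : t ∈ Icc (0 : ℝ) l) (hk : ∀ r ∈ Icc (0 : ℝ) t, ‖k r‖ ≤ A * Real.exp (κ * (t - r))) :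
    ‖∫ r in (0 : ℝ)..t, k r * (p r * u r)‖
      ≤ A * N * (∫ r in (0 : ℝ)..l, ‖p r‖) * Real.exp (κ * t) := by
  have hl : 0 ≤ l := ht.1.trans ht.2
  have hpi {a : ℝ} (ha : a ∈ Icc (0 : ℝ) l) : IntervalIntegrable (fun b => ‖p b‖) volume 0 a := by
    rw [intervalIntegrable_iff_integrableOn_Icc_of_le ha.1]
    exact (hp.mono_set (Icc_subset_Icc_right ha.2)).norm
  have hpt : ∀ r ∈ Ioc 0 t, ‖k r * (p r * u r)‖ ≤ ‖p r‖ * (A * N * Real.exp (κ * t)) := by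
    intro r hr
    calc ‖k r * (p r * u r)‖ = ‖k r‖ * (‖p r‖ * ‖u r‖) := by rw [norm_mul, norm_mul]
      _ ≤ (A * Real.exp (κ * (t - r))) * (‖p r‖ * (N * Real.exp (κ * r))) := by
          gcongr
          · exact hk r ⟨hr.1.le, hr.2⟩
          · exact hu r ⟨hr.1.le, hr.2.trans ht.2⟩
      _ = ‖p r‖ * (A * N * (Real.exp (κ * (t - r)) * Real.exp (κ * r))) := by ring
      _ = ‖p r‖ * (A * N * Real.exp (κ * t)) := by rw [← Real.exp_add]; ring_nf
  calc ‖∫ r in (0 : ℝ)..t, k r * (p r * u r)‖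
      ≤ ∫ r in (0 : ℝ)..t, ‖p r‖ * (A * N * Real.exp (κ * t)) :=
        intervalIntegral.norm_integral_le_of_norm_le ht.1 (.of_forall hpt)
          ((hpi ht).mul_const _)
    _ = (∫ r in (0 : ℝ)..t, ‖p r‖) * (A * N * Real.exp (κ * t)) :=
        intervalIntegral.integral_mul_const _ _
    _ ≤ (∫ r in (0 : ℝ)..l, ‖p r‖) * (A * N * Real.exp (κ * t)) := by
        gcongr
        exact intervalIntegral.integral_mono_interval le_rfl ht.1 ht.2
          (.of_forall fun _ => norm_nonneg _) (hpi ⟨hl, le_rfl⟩)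
    _ = A * N * (∫ r in (0 : ℝ)..l, ‖p r‖) * Real.exp (κ * t) := by ring

lemma norm_iterated_integral_le {q y : ℝ → 𝕜} {κ N t : ℝ} (hκ : 0 < κ) (hN : 0 ≤ N)
    (hq : IntegrableOn q (Icc 0 l)) (hy : ∀ r ∈ Icc (0 : ℝ) l, ‖y r‖ ≤ N * Real.exp (κ * r))
    (ht : t ∈ Icc (0 : ℝ) l) :
    ‖∫ a in (0 : ℝ)..t, ∫ b in (0 : ℝ)..a, q b * y b‖
      ≤ N * (∫ b in (0 : ℝ)..l, ‖q b‖) / κ * Real.exp (κ * t) := by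
  set Q := ∫ b in (0 : ℝ)..l, ‖q b‖
  have hQ : 0 ≤ Q := intervalIntegral.integral_nonneg (ht.1.trans ht.2) fun _ _ => norm_nonneg _
  have hinner : ∀ a ∈ Ioc 0 t, ‖∫ b in (0 : ℝ)..a, q b * y b‖ ≤ N * Q * Real.exp (κ * a) := by
    intro a ha
    simpa using norm_volterra_le (k := fun _ => 1) zero_le_one hN hq hy
      ⟨ha.1.le, ha.2.trans ht.2⟩ fun r hr => by
        simpa using mul_nonneg hκ.le (sub_nonneg.2 hr.2)
  calc ‖∫ a in (0 : ℝ)..t, ∫ b in (0 : ℝ)..a, q b * y b‖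
      ≤ ∫ a in (0 : ℝ)..t, N * Q * Real.exp (κ * a) :=
        intervalIntegral.norm_integral_le_of_norm_le ht.1 (.of_forall hinner)
          (Continuous.intervalIntegrable (by fun_prop) _ _)
    _ = N * Q / κ * (Real.exp (κ * t) - 1) := by
        rw [intervalIntegral.integral_const_mul,
          intervalIntegral.integral_comp_mul_left (fun x => Real.exp x) hκ.ne', integral_exp,
          mul_zero, Real.exp_zero, smul_eq_mul]
        ring
    _ ≤ N * Q / κ * Real.exp (κ * t) := by
        gcongr
        exact sub_le_self _ zero_le_one

section FixedPoint

variable {E : Type*} [NormedAddCommGroup E] [CompleteSpace E]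

lemma exists_fixedPoint_of_contraction (hl : 0 ≤ l) (Φ : (ℝ → E) → ℝ → E)
    (hcont : ∀ y, ContinuousOn y (Icc 0 l) → ContinuousOn (Φ y) (Icc 0 l))
    (hΦ : ∀ y z, ContinuousOn y (Icc 0 l) → ContinuousOn z (Icc 0 l) → ∀ N ≥ 0,
      (∀ t ∈ Icc (0 : ℝ) l, ‖y t - z t‖ ≤ N) → ∀ t ∈ Icc (0 : ℝ) l, ‖Φ y t - Φ z t‖ ≤ N / 2) :
    ∃ y, ContinuousOn y (Icc 0 l) ∧ ∀ t ∈ Icc (0 : ℝ) l, Φ y t = y t := by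
  have hext (y : C(Icc (0 : ℝ) l, E)) : ContinuousOn (IccExtend hl y) (Icc 0 l) :=
    y.continuous.Icc_extend'.continuousOn
  let F (y : C(Icc (0 : ℝ) l, E)) : C(Icc (0 : ℝ) l, E) :=
    ⟨fun t => Φ (IccExtend hl y) t, continuousOn_iff_continuous_domRestrict.1 (hcont _ (hext y))⟩
  have hF : ContractingWith (1 / 2) F := by
    refine ⟨by norm_num, LipschitzWith.of_dist_le_mul fun y z => ?_⟩
    refine (ContinuousMap.dist_le (by positivity)).2 fun t => ?_
    have hyz : ∀ r ∈ Icc (0 : ℝ) l, ‖IccExtend hl y r - IccExtend hl z r‖ ≤ dist y z := by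
      intro r hr
      rw [IccExtend_of_mem hl y hr, IccExtend_of_mem hl z hr, ← dist_eq_norm]
      exact ContinuousMap.dist_apply_le_dist _
    have hle := hΦ _ _ (hext y) (hext z) _ dist_nonneg hyz t t.2
    rw [← dist_eq_norm, div_eq_inv_mul] at hle
    exact hle.trans_eq (by norm_num)
  let y : C(Icc (0 : ℝ) l, E) := hF.fixedPoint F
  refine ⟨IccExtend hl y, hext y, fun t ht => ?_⟩
  rw [IccExtend_of_mem hl y ht]
  exact DFunLike.congr_fun hF.fixedPoint_isFixedPt.eq (⟨t, ht⟩ : Icc (0 : ℝ) l)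

-- The map is a contraction for the norm `sup ‖e^{-κ t} y t‖`.
lemma exists_fixedPoint_of_weighted_contraction [NormedSpace ℝ E] (hl : 0 ≤ l) (κ : ℝ)
    (Φ : (ℝ → E) → ℝ → E)
    (hcont : ∀ y, ContinuousOn y (Icc 0 l) → ContinuousOn (Φ y) (Icc 0 l))
    (hΦ : ∀ y z, ContinuousOn y (Icc 0 l) → ContinuousOn z (Icc 0 l) → ∀ N ≥ 0,
      (∀ t ∈ Icc (0 : ℝ) l, ‖y t - z t‖ ≤ N * Real.exp (κ * t)) →
      ∀ t ∈ Icc (0 : ℝ) l, ‖Φ y t - Φ z t‖ ≤ N / 2 * Real.exp (κ * t)) :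
    ∃ y, ContinuousOn y (Icc 0 l) ∧ ∀ t ∈ Icc (0 : ℝ) l, Φ y t = y t := by
  let W (κ : ℝ) (y : ℝ → E) (t : ℝ) : E := Real.exp (κ * t) • y t
  have hW (κ : ℝ) {y : ℝ → E} (hy : ContinuousOn y (Icc 0 l)) : ContinuousOn (W κ y) (Icc 0 l) :=
    ContinuousOn.smul (by fun_prop) hy
  have hnorm (κ : ℝ) (y z : ℝ → E) (t : ℝ) :
      ‖W κ y t - W κ z t‖ = ‖y t - z t‖ * Real.exp (κ * t) := by
    rw [← smul_sub, norm_smul, Real.norm_eq_abs, Real.abs_exp, mul_comm]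
  have hexp (t : ℝ) : Real.exp (κ * t) * Real.exp (-κ * t) = 1 := by
    rw [← Real.exp_add, neg_mul, add_neg_cancel, Real.exp_zero]
  obtain ⟨y, hy, hfix⟩ := exists_fixedPoint_of_contraction hl (fun y => W (-κ) (Φ (W κ y)))
    (fun y hy => hW _ (hcont _ (hW κ hy))) fun y z hy hz N hN hyz t ht => by
      have hle := hΦ _ _ (hW κ hy) (hW κ hz) N hN
        (fun r hr => (hnorm κ y z r).trans_le (by gcongr; exact hyz r hr)) t ht
      calc ‖W (-κ) (Φ (W κ y)) t - W (-κ) (Φ (W κ z)) t‖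
          ≤ N / 2 * Real.exp (κ * t) * Real.exp (-κ * t) := by rw [hnorm]; gcongr
        _ = N / 2 := by rw [mul_assoc, hexp, mul_one]
  refine ⟨W κ y, hW κ hy, fun t ht => ?_⟩
  calc Φ (W κ y) t = (Real.exp (κ * t) * Real.exp (-κ * t)) • Φ (W κ y) t := by
        rw [hexp, one_smul]
    _ = W κ y t := by rw [mul_smul]; exact congrArg _ (hfix t ht)

end FixedPoint

variable {q : ℝ → 𝕜}

lemma exists_isSol (hl : 0 ≤ l) (hq : IntegrableOn q (Icc 0 l)) (a b : 𝕜) :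
    ∃ u v : ℝ → 𝕜, IsSol l q (fun _ => 0) u v ∧ u 0 = a ∧ v 0 = b := by
  let V (y : ℝ → 𝕜) (t : ℝ) : 𝕜 := b + ∫ r in (0 : ℝ)..t, q r * y r
  let U (y : ℝ → 𝕜) (t : ℝ) : 𝕜 := a + ∫ x in (0 : ℝ)..t, V y x
  have hV {y : ℝ → 𝕜} (hy : ContinuousOn y (Icc 0 l)) :
      IsPrimitive l (V y) (fun t => q t * y t) :=
    isPrimitive_integral hl (hq.mul_continuousOn hy isCompact_Icc) b
  have hU {y : ℝ → 𝕜} (hy : ContinuousOn y (Icc 0 l)) : IsPrimitive l (U y) (V y) :=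
    isPrimitive_integral hl ((hV hy).continuousOn.integrableOn_compact isCompact_Icc) a
  have hsub {y z : ℝ → 𝕜} (hy : ContinuousOn y (Icc 0 l)) (hz : ContinuousOn z (Icc 0 l)) :
      ∀ t ∈ Icc (0 : ℝ) l,
        U y t - U z t = ∫ x in (0 : ℝ)..t, ∫ r in (0 : ℝ)..x, q r * (y r - z r) := by
    intro t ht
    rw [((hU hy).sub (hU hz)).eq t ht]
    simp only [U, intervalIntegral.integral_same, sub_self, zero_add]
    refine intervalIntegral.integral_congr fun x hx => ?_
    rw [uIcc_of_le ht.1] at hx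
    simpa [V, mul_sub] using ((hV hy).sub (hV hz)).eq x ⟨hx.1, hx.2.trans ht.2⟩
  set Q := ∫ r in (0 : ℝ)..l, ‖q r‖
  have hQ : 0 ≤ Q := intervalIntegral.integral_nonneg hl fun _ _ => norm_nonneg _
  obtain ⟨y, hy, hfix⟩ := exists_fixedPoint_of_weighted_contraction hl (2 * (Q + 1)) U
    (fun _ hy => (hU hy).continuousOn) fun y z hy hz N hN hyz t ht => by
      rw [hsub hy hz t ht]
      refine (norm_iterated_integral_le (by positivity) hN hq hyz ht).trans ?_
      gcongr ?_ * _
      rw [div_le_div_iff₀ (by positivity) two_pos]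
      nlinarith
  refine ⟨U y, V y, ⟨hU hy, (hV hy).congr fun t ht => ?_⟩, by simp [U], by simp [V]⟩
  rw [hfix t ht, sub_zero]

lemma exists_isFundamental (hl : 0 ≤ l) (hq : IntegrableOn q (Icc 0 l)) :
    ∃ c c' s s' : ℝ → 𝕜, IsFundamental l q c c' s s' := by
  obtain ⟨c, c', hc, hc0, hc0'⟩ := exists_isSol hl hq 1 0
  obtain ⟨s, s', hs, hs0, hs0'⟩ := exists_isSol hl hq 0 1
  exact ⟨c, c', s, s', hc, hs, hc0, hc0', hs0, hs0'⟩

end Existence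

/-! ### Perturbation of solutions -/

section Perturbation

variable {𝕜 : Type*} [RCLike 𝕜] {l : ℝ} {q p f c c' s s' u v u₀ v₀ : ℝ → 𝕜} {t A A' B κ : ℝ}

lemma IsFundamental.sub_eq_integral_kernel (h : IsFundamental l q c c' s s')
    (hu₀ : IsSol l q (fun _ => 0) u₀ v₀) (hu : IsSol l q f u v) (hu0 : u 0 = u₀ 0)
    (hv0 : v 0 = v₀ 0) (hf : IntegrableOn f (Icc 0 l)) (ht : t ∈ Icc (0 : ℝ) l) :
    u t - u₀ t = (∫ r in (0 : ℝ)..t, (c t * s r - s t * c r) * f r) ∧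
    v t - v₀ t = ∫ r in (0 : ℝ)..t, (c' t * s r - s' t * c r) * f r := by
  have hs := (isPrimitive_integral h.nonneg
    (hf.mul_continuousOn h.sin.fst.continuousOn isCompact_Icc) 0).intervalIntegrable ht
  have hc := (isPrimitive_integral h.nonneg
    (hf.mul_continuousOn h.cos.fst.continuousOn isCompact_Icc) 0).intervalIntegrable ht
  have hkernel (a b : 𝕜) : ∫ r in (0 : ℝ)..t, (a * s r - b * c r) * f r =
      (a * ∫ r in (0 : ℝ)..t, f r * s r) - b * ∫ r in (0 : ℝ)..t, f r * c r := by
    rw [← intervalIntegral.integral_const_mul, ← intervalIntegral.integral_const_mul,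
      ← intervalIntegral.integral_sub (hs.const_mul a) (hc.const_mul b)]
    congr 1
    ext r
    ring
  obtain ⟨hu₁, hv₁⟩ := h.eq_fst_and_eq_snd hu ht
  obtain ⟨hu₂, hv₂⟩ := h.eq_of_homogeneous hu₀ ht
  rw [hkernel, hkernel, hu₁, hv₁, hu₂, hv₂, hu0, hv0]
  constructor <;> ring

-- Apply `h` with `N` the maximum of `‖u r‖ e^{-κ r}`: it gives `N ≤ B + N / 2`.
lemma norm_le_two_mul_exp_of_bootstrap {E : Type*} [NormedAddCommGroup E] {u : ℝ → E}
    (hu : ContinuousOn u (Icc 0 l))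
    (h : ∀ N ≥ 0, (∀ r ∈ Icc (0 : ℝ) l, ‖u r‖ ≤ N * Real.exp (κ * r)) →
      ∀ r ∈ Icc (0 : ℝ) l, ‖u r‖ ≤ (B + N / 2) * Real.exp (κ * r)) (ht : t ∈ Icc (0 : ℝ) l) :
    ‖u t‖ ≤ 2 * B * Real.exp (κ * t) := by
  obtain ⟨τ, hτ, hmax⟩ := isCompact_Icc.exists_isMaxOn ⟨t, ht⟩
    (f := fun r => ‖u r‖ / Real.exp (κ * r))
    (hu.norm.div (by fun_prop) fun r _ => (Real.exp_pos _).ne')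
  have hbound (r : ℝ) (hr : r ∈ Icc (0 : ℝ) l) :
      ‖u r‖ ≤ ‖u τ‖ / Real.exp (κ * τ) * Real.exp (κ * r) :=
    (div_le_iff₀ (Real.exp_pos _)).1 (hmax hr)
  have hτle := (div_le_iff₀ (Real.exp_pos _)).2 (h _ (by positivity) hbound τ hτ)
  refine (hbound t ht).trans ?_
  gcongr
  linarith

variable (h : IsFundamental l q c c' s s') (hu₀ : IsSol l q (fun _ => 0) u₀ v₀)
  (hu : IsSol l q (fun t => p t * u t) u v) (hu0 : u 0 = u₀ 0) (hv0 : v 0 = v₀ 0)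
  (hp : IntegrableOn p (Icc 0 l)) (hA : 0 ≤ A)
  (hAp : A * (∫ r in (0 : ℝ)..l, ‖p r‖) ≤ 1 / 2)
  (hk : ∀ t ∈ Icc (0 : ℝ) l, ∀ r ∈ Icc (0 : ℝ) t,
    ‖c t * s r - s t * c r‖ ≤ A * Real.exp (κ * (t - r)))
  (hB : ∀ t ∈ Icc (0 : ℝ) l, ‖u₀ t‖ ≤ B * Real.exp (κ * t))

include h hu₀ hu hu0 hv0 hp hA hAp hk hB

lemma IsFundamental.norm_perturbed_le (ht : t ∈ Icc (0 : ℝ) l) :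
    ‖u t‖ ≤ 2 * B * Real.exp (κ * t) := by
  refine norm_le_two_mul_exp_of_bootstrap hu.fst.continuousOn (fun N hN huN r hr => ?_) ht
  have hdiff := norm_volterra_le hA hN hp huN hr (hk r hr)
  rw [← (h.sub_eq_integral_kernel hu₀ hu hu0 hv0
    (hp.mul_continuousOn hu.fst.continuousOn isCompact_Icc) hr).1] at hdiff
  calc ‖u r‖ ≤ ‖u₀ r‖ + ‖u r - u₀ r‖ := norm_le_norm_add_norm_sub' _ _
    _ ≤ B * Real.exp (κ * r) + A * (∫ r in (0 : ℝ)..l, ‖p r‖) * N * Real.exp (κ * r) := by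
      rw [mul_right_comm A]
      gcongr
      exact hB r hr
    _ ≤ B * Real.exp (κ * r) + 1 / 2 * N * Real.exp (κ * r) := by gcongr
    _ = (B + N / 2) * Real.exp (κ * r) := by ring

lemma IsFundamental.norm_sub_le_of_perturbation (hA' : 0 ≤ A')
    (hk' : ∀ t ∈ Icc (0 : ℝ) l, ∀ r ∈ Icc (0 : ℝ) t,
      ‖c' t * s r - s' t * c r‖ ≤ A' * Real.exp (κ * (t - r)))
    (ht : t ∈ Icc (0 : ℝ) l) :
    ‖u t - u₀ t‖ ≤ A * (2 * B) * (∫ r in (0 : ℝ)..l, ‖p r‖) * Real.exp (κ * t) ∧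
    ‖v t - v₀ t‖ ≤ A' * (2 * B) * (∫ r in (0 : ℝ)..l, ‖p r‖) * Real.exp (κ * t) := by
  have hu2 (r : ℝ) (hr : r ∈ Icc (0 : ℝ) l) : ‖u r‖ ≤ 2 * B * Real.exp (κ * r) :=
    h.norm_perturbed_le hu₀ hu hu0 hv0 hp hA hAp hk hB hr
  have hB0 : 0 ≤ 2 * B := by simpa using (norm_nonneg _).trans (hu2 0 ⟨le_rfl, h.nonneg⟩)
  obtain ⟨hut, hvt⟩ := h.sub_eq_integral_kernel hu₀ hu hu0 hv0
    (hp.mul_continuousOn hu.fst.continuousOn isCompact_Icc) ht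
  rw [hut, hvt]
  exact ⟨norm_volterra_le hA hB0 hp hu2 ht (hk t ht),
    norm_volterra_le hA' hB0 hp hu2 ht (hk' t ht)⟩

end Perturbation

/-! ### Dependence on the spectral parameter -/

section Parameter

open Filter Topology

variable {𝕜 : Type*} [RCLike 𝕜] {l : ℝ} {V : ℝ → 𝕜}

lemma IsSol.change_parameter {u v : ℝ → 𝕜} {z w : 𝕜}
    (h : IsSol l (fun t => V t - w) (fun _ => 0) u v) :
    IsSol l (fun t => V t - z) (fun t => (w - z) * u t) u v :=
  h.congr_ae (Eventually.of_forall fun t => by ring)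

lemma exists_bound_kernel {c s f g : ℝ → 𝕜} (hc : ContinuousOn c (Icc 0 l))
    (hs : ContinuousOn s (Icc 0 l)) (hf : ContinuousOn f (Icc 0 l))
    (hg : ContinuousOn g (Icc 0 l)) :
    ∃ A ≥ 0, ∀ t ∈ Icc (0 : ℝ) l, ∀ r ∈ Icc (0 : ℝ) t, ‖f t * s r - g t * c r‖ ≤ A := by
  have hfst : MapsTo Prod.fst (Icc (0 : ℝ) l ×ˢ Icc (0 : ℝ) l) (Icc 0 l) := fun _ h => h.1
  have hsnd : MapsTo Prod.snd (Icc (0 : ℝ) l ×ˢ Icc (0 : ℝ) l) (Icc 0 l) := fun _ h => h.2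
  obtain ⟨A, hA⟩ := (isCompact_Icc.prod isCompact_Icc).exists_bound_of_continuousOn
    (((hf.comp continuousOn_fst hfst).mul (hs.comp continuousOn_snd hsnd)).sub
      ((hg.comp continuousOn_fst hfst).mul (hc.comp continuousOn_snd hsnd)))
  exact ⟨max A 0, le_max_right _ _, fun t ht r hr =>
    le_max_of_le_left (hA (t, r) ⟨ht, hr.1, hr.2.trans ht.2⟩)⟩

variable (l V) in
/-- A fundamental system of `-u'' + V u = z u` on `[0,l]` for every spectral parameter `z`. In the
notation of the theorem, `sin z` is `u₁(·; z)` and `cos z` is `u₂(·; z)`. -/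
structure FundamentalFamily where
  (cos cosDeriv sin sinDeriv : 𝕜 → ℝ → 𝕜)
  isFundamental : ∀ z, IsFundamental l (fun t => V t - z) (cos z) (cosDeriv z) (sin z) (sinDeriv z)

lemma nonempty_fundamentalFamily (hl : 0 ≤ l) (hV : IntegrableOn V (Icc 0 l)) :
    Nonempty (FundamentalFamily l V) := by
  choose c c' s s' h using fun z : 𝕜 =>
    exists_isFundamental hl (hV.sub (integrableOn_const (C := z) (by simp)))
  exact ⟨⟨c, c', s, s', h⟩⟩

namespace FundamentalFamily

variable (F : FundamentalFamily l V) {u v : 𝕜 → ℝ → 𝕜} {a b : 𝕜} (z₀ : 𝕜)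
include F

lemma nonneg : 0 ≤ l := (F.isFundamental 0).nonneg

lemma exists_norm_sub_le (hu : ∀ z, IsSol l (fun t => V t - z) (fun _ => 0) (u z) (v z))
    (hu0 : ∀ z, u z 0 = a) (hv0 : ∀ z, v z 0 = b) :
    ∃ D, ∀ᶠ z in 𝓝 z₀, ∀ t ∈ Icc (0 : ℝ) l,
      ‖u z t - u z₀ t‖ ≤ D * ‖z - z₀‖ ∧ ‖v z t - v z₀ t‖ ≤ D * ‖z - z₀‖ := by
  have h := F.isFundamental z₀
  obtain ⟨A, hA, hk⟩ := exists_bound_kernel h.cos.fst.continuousOn h.sin.fst.continuousOn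
    h.cos.fst.continuousOn h.sin.fst.continuousOn
  obtain ⟨A', hA', hk'⟩ := exists_bound_kernel h.cos.fst.continuousOn h.sin.fst.continuousOn
    h.cos.snd.continuousOn h.sin.snd.continuousOn
  obtain ⟨B, hB⟩ := isCompact_Icc.exists_bound_of_continuousOn (hu z₀).fst.continuousOn
  refine ⟨max A A' * (2 * B) * l, ?_⟩
  have hsmall : ∀ᶠ z in 𝓝 z₀, A * (l * ‖z - z₀‖) < 1 / 2 :=
    ContinuousAt.eventually_lt (f := fun z => A * (l * ‖z - z₀‖)) (by fun_prop)
      continuousAt_const (by simp)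
  filter_upwards [hsmall] with z hz t ht
  have hB0 : 0 ≤ B := (norm_nonneg _).trans (hB t ht)
  have hl : 0 ≤ l := h.nonneg
  have hP : ∫ _ in (0 : ℝ)..l, ‖z - z₀‖ = l * ‖z - z₀‖ := by simp
  obtain ⟨hut, hvt⟩ := h.norm_sub_le_of_perturbation (p := fun _ => z - z₀) (κ := 0) (B := B)
    (hu z₀) (hu z).change_parameter (by rw [hu0, hu0]) (by rw [hv0, hv0])
    (integrableOn_const (by simp)) hA (by rw [hP]; exact hz.le) (by simpa using hk)
    (by simpa using hB) hA' (by simpa using hk') ht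
  rw [hP, zero_mul, Real.exp_zero, mul_one] at hut hvt
  rw [mul_assoc _ l]
  exact ⟨hut.trans (by gcongr; exact le_max_left _ _),
    hvt.trans (by gcongr; exact le_max_right _ _)⟩

lemma tendstoUniformlyOn (hu : ∀ z, IsSol l (fun t => V t - z) (fun _ => 0) (u z) (v z))
    (hu0 : ∀ z, u z 0 = a) (hv0 : ∀ z, v z 0 = b) :
    TendstoUniformlyOn u (u z₀) (𝓝 z₀) (Icc 0 l) ∧
      TendstoUniformlyOn v (v z₀) (𝓝 z₀) (Icc 0 l) := by
  obtain ⟨D, hD⟩ := F.exists_norm_sub_le z₀ hu hu0 hv0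
  have hlim (ε : ℝ) (hε : 0 < ε) : ∀ᶠ z in 𝓝 z₀, D * ‖z - z₀‖ < ε :=
    ContinuousAt.eventually_lt (f := fun z => D * ‖z - z₀‖) (by fun_prop)
      continuousAt_const (by simpa)
  constructor <;> rw [Metric.tendstoUniformlyOn_iff] <;> intro ε hε <;>
    filter_upwards [hD, hlim ε hε] with z hz hε t ht <;> rw [dist_comm, dist_eq_norm]
  · exact (hz t ht).1.trans_lt hε
  · exact (hz t ht).2.trans_lt hε

lemma tendstoUniformlyOn_cos : TendstoUniformlyOn F.cos (F.cos z₀) (𝓝 z₀) (Icc 0 l) :=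
  (F.tendstoUniformlyOn z₀ (fun z => (F.isFundamental z).cos)
    (fun z => (F.isFundamental z).cos_zero) fun z => (F.isFundamental z).cos_deriv_zero).1

lemma tendstoUniformlyOn_sin :
    TendstoUniformlyOn F.sin (F.sin z₀) (𝓝 z₀) (Icc 0 l) ∧
      TendstoUniformlyOn F.sinDeriv (F.sinDeriv z₀) (𝓝 z₀) (Icc 0 l) :=
  F.tendstoUniformlyOn z₀ (fun z => (F.isFundamental z).sin)
    (fun z => (F.isFundamental z).sin_zero) fun z => (F.isFundamental z).sin_deriv_zero

variable {t : ℝ} (ht : t ∈ Icc (0 : ℝ) l)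
include ht

lemma continuous_cos : Continuous fun z => F.cos z t :=
  continuous_iff_continuousAt.2 fun z₀ => (F.tendstoUniformlyOn_cos z₀).tendsto_at ht

lemma continuous_sin : Continuous fun z => F.sin z t :=
  continuous_iff_continuousAt.2 fun z₀ => (F.tendstoUniformlyOn_sin z₀).1.tendsto_at ht

lemma continuous_sinDeriv : Continuous fun z => F.sinDeriv z t :=
  continuous_iff_continuousAt.2 fun z₀ => (F.tendstoUniformlyOn_sin z₀).2.tendsto_at ht

end FundamentalFamily

end Parameter

section Zeros

open Filter Topology

variable {l : ℝ}

lemma IsFundamental.integral_sin_sq_pos {q c c' s s' : ℝ → ℝ} (hl : 0 < l)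
    (h : IsFundamental l q c c' s s') : 0 < ∫ t in (0 : ℝ)..l, s t * s t := by
  have hc := h.sin.fst.continuousOn
  refine intervalIntegral.integral_pos hl (hc.mul hc) (fun _ _ => mul_self_nonneg _) ?_
  by_contra! hs
  have hsin (t : ℝ) (ht : t ∈ Icc (0 : ℝ) l) : s t = 0 := mul_self_eq_zero.1
    ((hs t ht).antisymm (mul_self_nonneg _))
  have hderiv : (fun t => (s' t : ℂ)) =ᵐ[edgeMeasure l] 0 := by
    refine ae_eq_zero_of_primitive hl h.ofReal.sin.fst.integrableOn fun t ht => ?_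
    simpa [hsin t ht, h.sin_zero] using (h.ofReal.sin.fst.eq t ht).symm
  have h0 := eq_zero_of_ae hl h.ofReal.sin.snd.continuousOn hderiv 0 ⟨le_rfl, hl.le⟩
  simp [h.sin_deriv_zero] at h0

namespace FundamentalFamily

variable {V : ℝ → ℝ} (F : FundamentalFamily l V) {x : ℝ}

lemma tendsto_integral_sin_mul_sin :
    Tendsto (fun y => ∫ t in (0 : ℝ)..l, F.sin x t * F.sin y t) (𝓝 x)
      (𝓝 (∫ t in (0 : ℝ)..l, F.sin x t * F.sin x t)) := by
  have hcont (y : ℝ) : ContinuousOn (F.sin y) (Icc 0 l) :=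
    (F.isFundamental y).sin.fst.continuousOn
  have hlim : TendstoUniformlyOn (fun y t => F.sin x t * F.sin y t)
      (fun t => F.sin x t * F.sin x t) (𝓝 x) (Icc 0 l) := by
    rw [← tendstoLocallyUniformlyOn_iff_tendstoUniformlyOn_of_compact isCompact_Icc]
    have hconst : TendstoUniformlyOn (fun _ => F.sin x) (F.sin x) (𝓝 x) (Icc 0 l) :=
      Metric.tendstoUniformlyOn_iff.2 fun ε hε => by simp [hε]
    exact hconst.tendstoLocallyUniformlyOn.mul₀
      (F.tendstoUniformlyOn_sin x).1.tendstoLocallyUniformlyOn (hcont x) (hcont x)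
  rw [← uIcc_of_le F.nonneg] at hlim hcont
  exact TendstoUniformlyOn.tendsto_intervalIntegral_of_continuousOn
    (Eventually.of_forall fun y => (hcont x).mul (hcont y)) hlim

-- Lagrange's identity for `sin x` and `sin y` reads
-- `S'(x) S(y) = (y - x) ∫ sin x · sin y` where `S(x) = 0`.
lemma eventually_sign_sin_near_zero (hl : 0 < l) (hx : F.sin x l = 0) :
    ∀ᶠ y in 𝓝[≠] x, 0 < (y - x) * (F.sinDeriv x l * F.sin y l) := by
  have hpos := F.tendsto_integral_sin_mul_sin.eventually_const_lt
    ((F.isFundamental x).integral_sin_sq_pos hl)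
  filter_upwards [self_mem_nhdsWithin, nhdsWithin_le_nhds hpos] with y hyx hy
  have hlag := (F.isFundamental x).sin.lagrange
    ((F.isFundamental y).sin.change_parameter (z := x)) ⟨hl.le, le_rfl⟩
  have hint : ∫ t in (0 : ℝ)..l, (0 * F.sin y t - F.sin x t * ((y - x) * F.sin y t)) =
      -(y - x) * ∫ t in (0 : ℝ)..l, F.sin x t * F.sin y t := by
    rw [← intervalIntegral.integral_const_mul]
    congr 1
    ext t
    ring
  rw [hint, hx, (F.isFundamental x).sin_zero, (F.isFundamental y).sin_zero] at hlag
  have hprod : (y - x) * (F.sinDeriv x l * F.sin y l) =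
      (y - x) ^ 2 * ∫ t in (0 : ℝ)..l, F.sin x t * F.sin y t := by
    linear_combination (x - y) * hlag
  rw [hprod]
  have : y - x ≠ 0 := sub_ne_zero.2 hyx
  positivity

end FundamentalFamily

end Zeros

/-! ### Asymptotics in the spectral parameter -/

section Asymptotics

open Filter Topology

lemma norm_cos_le_exp_abs_im (z : ℂ) : ‖Complex.cos z‖ ≤ Real.exp |z.im| := by
  have hbound : ‖Complex.exp (z * Complex.I)‖ ≤ Real.exp |z.im| ∧
      ‖Complex.exp (-z * Complex.I)‖ ≤ Real.exp |z.im| := by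
    simp [Complex.norm_exp, neg_le_abs, le_abs_self]
  calc ‖Complex.cos z‖ ≤ (‖Complex.exp (z * Complex.I)‖ + ‖Complex.exp (-z * Complex.I)‖) / 2 := by
        simp only [Complex.cos, norm_div, Complex.norm_ofNat]
        gcongr
        exact norm_add_le _ _
    _ ≤ Real.exp |z.im| := by linarith

lemma norm_sin_le_exp_abs_im (z : ℂ) : ‖Complex.sin z‖ ≤ Real.exp |z.im| := by
  have h := norm_cos_le_exp_abs_im (Real.pi / 2 - z : ℂ)
  simpa [Complex.cos_pi_div_two_sub, Complex.sub_im] using h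

lemma abs_im_mul_ofReal (k : ℂ) {t : ℝ} (ht : 0 ≤ t) : |(k * t : ℂ).im| = |k.im| * t := by
  rw [Complex.im_mul_ofReal, abs_mul, abs_of_nonneg ht]

variable {l t : ℝ} {k : ℂ}

lemma isFundamental_free (hl : 0 ≤ l) (hk : k ≠ 0) :
    IsFundamental l (fun _ => -k ^ 2) (fun t => Complex.cos (k * t))
      (fun t => -k * Complex.sin (k * t)) (fun t => Complex.sin (k * t) / k)
      (fun t => Complex.cos (k * t)) := by
  have hlin (t : ℝ) : HasDerivAt (fun t : ℝ => k * (t : ℂ)) k t := by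
    simpa using (Complex.ofRealCLM.hasDerivAt (x := t)).const_mul k
  have hcos (t : ℝ) :
      HasDerivAt (fun t : ℝ => Complex.cos (k * t)) (-k * Complex.sin (k * t)) t :=
    ((Complex.hasDerivAt_cos _).comp t (hlin t)).congr_deriv (by ring)
  have hsin (t : ℝ) : HasDerivAt (fun t : ℝ => Complex.sin (k * t)) (k * Complex.cos (k * t)) t :=
    ((Complex.hasDerivAt_sin _).comp t (hlin t)).congr_deriv (by ring)
  refine ⟨⟨?_, ?_⟩, ⟨?_, ?_⟩, by simp, by simp, by simp, by simp⟩
  · exact isPrimitive_of_hasDerivAt hl hcos (by fun_prop)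
  · exact isPrimitive_of_hasDerivAt hl
      (fun t => ((hsin t).const_mul (-k)).congr_deriv (by ring)) (by fun_prop)
  · exact isPrimitive_of_hasDerivAt hl
      (fun t => ((hsin t).div_const k).congr_deriv (by field_simp)) (by fun_prop)
  · exact isPrimitive_of_hasDerivAt hl
      (fun t => (hcos t).congr_deriv (by field_simp; simp)) (by fun_prop)

variable {V c c' s s' : ℝ → ℂ} {u v u₀ v₀ : ℝ → ℂ} {B : ℝ}

lemma norm_sub_free_le (hV : IntegrableOn V (Icc 0 l)) (hk : k ≠ 0)
    (hkV : 2 * (∫ t in (0 : ℝ)..l, ‖V t‖) ≤ ‖k‖)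
    (hu₀ : IsSol l (fun _ => -k ^ 2) (fun _ => 0) u₀ v₀)
    (hu : IsSol l (fun t => V t - k ^ 2) (fun _ => 0) u v) (hu0 : u 0 = u₀ 0) (hv0 : v 0 = v₀ 0)
    (hB : ∀ t ∈ Icc (0 : ℝ) l, ‖u₀ t‖ ≤ B * Real.exp (|k.im| * t)) (ht : t ∈ Icc (0 : ℝ) l) :
    ‖u t - u₀ t‖ ≤ 2 * B * (∫ t in (0 : ℝ)..l, ‖V t‖) / ‖k‖ * Real.exp (|k.im| * t) ∧
    ‖v t - v₀ t‖ ≤ 2 * B * (∫ t in (0 : ℝ)..l, ‖V t‖) * Real.exp (|k.im| * t) := by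
  have hkpos : 0 < ‖k‖ := norm_pos_iff.2 hk
  have hsol : IsSol l (fun _ => -k ^ 2) (fun t => -V t * u t) u v :=
    hu.congr_ae (Eventually.of_forall fun t => by ring)
  have hsin (t r : ℝ) : Complex.cos (k * t) * (Complex.sin (k * r) / k)
      - Complex.sin (k * t) / k * Complex.cos (k * r)
      = -Complex.sin (k * (t - r : ℝ)) / k := by
    rw [Complex.ofReal_sub, mul_sub, Complex.sin_sub]
    ring
  have hcos (t r : ℝ) : -k * Complex.sin (k * t) * (Complex.sin (k * r) / k)
      - Complex.cos (k * t) * Complex.cos (k * r) = -Complex.cos (k * (t - r : ℝ)) := by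
    rw [Complex.ofReal_sub, mul_sub, Complex.cos_sub]
    field_simp
    ring
  have h := (isFundamental_free hu.fst.nonneg hk).norm_sub_le_of_perturbation
    (p := fun t => -V t) (A := 1 / ‖k‖) (A' := 1) hu₀ hsol hu0 hv0 hV.neg (by positivity)
    (by simpa [inv_mul_le_iff₀ hkpos, div_eq_mul_inv] using by linarith)
    (fun t _ r hr => by
      rw [hsin, norm_div, norm_neg, ← abs_im_mul_ofReal k (sub_nonneg.2 hr.2), one_div_mul_eq_div]
      gcongr
      exact norm_sin_le_exp_abs_im _)
    hB zero_le_one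
    (fun t _ r hr => by
      rw [hcos, norm_neg, ← abs_im_mul_ofReal k (sub_nonneg.2 hr.2), one_mul]
      exact norm_cos_le_exp_abs_im _) ht
  simp only [norm_neg] at h
  exact ⟨h.1.trans_eq (by ring), h.2.trans_eq (by ring)⟩

namespace IsFundamental

variable (h : IsFundamental l (fun t => V t - k ^ 2) c c' s s') (hV : IntegrableOn V (Icc 0 l))
  (hk : k ≠ 0) (hkV : 2 * (∫ t in (0 : ℝ)..l, ‖V t‖) ≤ ‖k‖) (ht : t ∈ Icc (0 : ℝ) l)
include h hV hk hkV ht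

lemma norm_sin_sub_free_le :
    ‖s t - Complex.sin (k * t) / k‖ ≤
        2 * (∫ t in (0 : ℝ)..l, ‖V t‖) / ‖k‖ ^ 2 * Real.exp (|k.im| * t) ∧
      ‖s' t - Complex.cos (k * t)‖ ≤
        2 * (∫ t in (0 : ℝ)..l, ‖V t‖) / ‖k‖ * Real.exp (|k.im| * t) := by
  have hfree := isFundamental_free h.nonneg hk
  have hdiff := norm_sub_free_le (B := 1 / ‖k‖) hV hk hkV hfree.sin h.sin
    (h.sin_zero.trans hfree.sin_zero.symm) (h.sin_deriv_zero.trans hfree.sin_deriv_zero.symm)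
    (fun t ht => by
      rw [norm_div, ← abs_im_mul_ofReal k ht.1, one_div_mul_eq_div]
      gcongr
      exact norm_sin_le_exp_abs_im _) ht
  exact ⟨hdiff.1.trans_eq (by ring), hdiff.2.trans_eq (by ring)⟩

lemma norm_cos_sub_free_le :
    ‖c t - Complex.cos (k * t)‖ ≤
      2 * (∫ t in (0 : ℝ)..l, ‖V t‖) / ‖k‖ * Real.exp (|k.im| * t) := by
  have hfree := isFundamental_free h.nonneg hk
  have hdiff := norm_sub_free_le (B := 1) hV hk hkV hfree.cos h.cos
    (h.cos_zero.trans hfree.cos_zero.symm) (h.cos_deriv_zero.trans hfree.cos_deriv_zero.symm)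
    (fun t ht => by
      rw [← abs_im_mul_ofReal k ht.1, one_mul]
      exact norm_cos_le_exp_abs_im _) ht
  exact hdiff.1.trans_eq (by ring)

end IsFundamental

namespace FundamentalFamily

variable {V : ℝ → ℝ} (F : FundamentalFamily l V) (hV : IntegrableOn V (Icc 0 l))
include F hV

lemma norm_sub_free_le {x : ℝ} (hkx : k ^ 2 = x) (hk : k ≠ 0)
    (hkV : 2 * (∫ t in (0 : ℝ)..l, ‖V t‖) ≤ ‖k‖) (ht : t ∈ Icc (0 : ℝ) l) :
    ‖(F.sin x t : ℂ) - Complex.sin (k * t) / k‖ ≤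
        2 * (∫ t in (0 : ℝ)..l, ‖V t‖) / ‖k‖ ^ 2 * Real.exp (|k.im| * t) ∧
      ‖(F.sinDeriv x t : ℂ) - Complex.cos (k * t)‖ ≤
        2 * (∫ t in (0 : ℝ)..l, ‖V t‖) / ‖k‖ * Real.exp (|k.im| * t) ∧
      ‖(F.cos x t : ℂ) - Complex.cos (k * t)‖ ≤
        2 * (∫ t in (0 : ℝ)..l, ‖V t‖) / ‖k‖ * Real.exp (|k.im| * t) := by
  have h := (F.isFundamental x).ofReal
  simp only [Complex.ofReal_sub, ← hkx] at h
  have hnorm : ∫ t in (0 : ℝ)..l, ‖(V t : ℂ)‖ = ∫ t in (0 : ℝ)..l, ‖V t‖ := by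
    simp only [Complex.norm_real]
  rw [← hnorm] at hkV ⊢
  obtain ⟨hsin, hsinDeriv⟩ := h.norm_sin_sub_free_le hV.ofReal hk hkV ht
  exact ⟨hsin, hsinDeriv, h.norm_cos_sub_free_le hV.ofReal hk hkV ht⟩

lemma tendsto_mul_sin_sub (ht : t ∈ Icc (0 : ℝ) l) :
    Tendsto (fun k : ℝ => k * F.sin (k ^ 2) t - Real.sin (k * t)) atTop (𝓝 0) := by
  refine squeeze_zero_norm' ?_
    (tendsto_const_nhds (x := 2 * ∫ t in (0 : ℝ)..l, ‖V t‖).div_atTop tendsto_id)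
  filter_upwards [eventually_gt_atTop 0, eventually_ge_atTop (2 * ∫ t in (0 : ℝ)..l, ‖V t‖)]
    with k hk hkV
  have h := (F.norm_sub_free_le hV (k := (k : ℂ)) (x := k ^ 2) (by push_cast; rfl)
    (by exact_mod_cast hk.ne') (by simpa [abs_of_pos hk] using hkV) ht).1
  have hcast : (F.sin (k ^ 2) t : ℂ) - Complex.sin (k * t) / k =
      ((F.sin (k ^ 2) t - Real.sin (k * t) / k : ℝ) : ℂ) := by push_cast; rfl
  rw [hcast, Complex.norm_real, Complex.norm_real, Complex.ofReal_im, abs_zero, zero_mul,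
    Real.exp_zero, mul_one, Real.norm_of_nonneg hk.le] at h
  calc ‖k * F.sin (k ^ 2) t - Real.sin (k * t)‖
      = k * ‖F.sin (k ^ 2) t - Real.sin (k * t) / k‖ := by
        rw [← Real.norm_of_nonneg hk.le, ← norm_mul, Real.norm_of_nonneg hk.le, mul_sub,
          mul_div_cancel₀ _ hk.ne']
    _ ≤ k * (2 * (∫ t in (0 : ℝ)..l, ‖V t‖) / k ^ 2) := by gcongr
    _ = 2 * (∫ t in (0 : ℝ)..l, ‖V t‖) / id k := by simp only [id]; field_simp

end FundamentalFamily

end Asymptotics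

section Asymptotics

open Filter Topology

variable {l t : ℝ}

lemma exists_zero_gt_of_frequently_pos_of_frequently_neg {f : ℝ → ℝ} (hf : Continuous f)
    (hpos : ∃ᶠ x in atTop, 0 < f x) (hneg : ∃ᶠ x in atTop, f x < 0) (X : ℝ) :
    ∃ x > X, f x = 0 := by
  obtain ⟨a, ha, hfa⟩ := frequently_atTop'.1 hpos X
  obtain ⟨b, hb, hfb⟩ := frequently_atTop'.1 hneg X
  obtain ⟨x, hx, hfx⟩ := intermediate_value_uIcc (hf.continuousOn (s := uIcc a b))
    (mem_uIcc.2 (Or.inr ⟨hfb.le, hfa.le⟩))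
  exact ⟨x, (lt_min ha hb).trans_le hx.1, hfx⟩

lemma tendsto_exp_neg_mul_hyperbolic (ht : 0 < t) :
    Tendsto (fun κ => Real.exp (-(κ * t)) * Real.sinh (κ * t)) atTop (𝓝 (1 / 2)) ∧
      Tendsto (fun κ => Real.exp (-(κ * t)) * Real.cosh (κ * t)) atTop (𝓝 (1 / 2)) := by
  have hexp : Tendsto (fun κ => Real.exp (-(κ * t)) ^ 2 / 2) atTop (𝓝 0) := by
    have := (Real.tendsto_exp_neg_atTop_nhds_zero.comp (tendsto_id.atTop_mul_const ht)).pow 2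
    simpa using this.div_const 2
  have hmul (κ : ℝ) : Real.exp (-(κ * t)) * Real.exp (κ * t) = 1 := by
    rw [← Real.exp_add, neg_add_cancel, Real.exp_zero]
  constructor
  · refine Tendsto.congr (fun κ => ?_) (by simpa only [sub_zero] using hexp.const_sub (1 / 2))
    rw [Real.sinh_eq]
    linear_combination - (1 / 2) * hmul κ
  · refine Tendsto.congr (fun κ => ?_) (by simpa only [add_zero] using hexp.const_add (1 / 2))
    rw [Real.cosh_eq]
    linear_combination - (1 / 2) * hmul κ

lemma tendsto_exp_neg_mul_of_norm_sub_le {f g : ℝ → ℝ} {D a : ℝ}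
    (hg : Tendsto (fun κ => Real.exp (-(κ * t)) * g κ) atTop (𝓝 a))
    (h : ∀ᶠ κ : ℝ in atTop, ‖f κ - g κ‖ ≤ D / κ * Real.exp (κ * t)) :
    Tendsto (fun κ => Real.exp (-(κ * t)) * f κ) atTop (𝓝 a) := by
  have hdiff : Tendsto (fun κ => Real.exp (-(κ * t)) * f κ - Real.exp (-(κ * t)) * g κ) atTop
      (𝓝 0) := by
    refine squeeze_zero_norm' ?_ (tendsto_const_nhds (x := D).div_atTop tendsto_id)
    filter_upwards [h] with κ hκ
    calc ‖Real.exp (-(κ * t)) * f κ - Real.exp (-(κ * t)) * g κ‖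
        = Real.exp (-(κ * t)) * ‖f κ - g κ‖ := by
          rw [← mul_sub, norm_mul, Real.norm_of_nonneg (Real.exp_pos _).le]
      _ ≤ Real.exp (-(κ * t)) * (D / κ * Real.exp (κ * t)) := by gcongr
      _ = D / κ * Real.exp (-(κ * t) + κ * t) := by rw [Real.exp_add]; ring
      _ = D / id κ := by simp
  simpa using hdiff.add hg

lemma eventually_atBot_iff_neg_sq {p : ℝ → Prop} :
    (∀ᶠ x in atBot, p x) ↔ ∀ᶠ κ : ℝ in atTop, p (-κ ^ 2) := by
  refine ⟨fun h => (tendsto_neg_atTop_atBot.comp (tendsto_pow_atTop two_ne_zero)).eventually h,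
    fun h => ?_⟩
  have hsqrt : Tendsto (fun x : ℝ => √(-x)) atBot atTop :=
    Real.tendsto_sqrt_atTop.comp tendsto_neg_atBot_atTop
  filter_upwards [hsqrt.eventually h, eventually_le_atBot 0] with x hx hx0
  rwa [Real.sq_sqrt (neg_nonneg.2 hx0), neg_neg] at hx

namespace FundamentalFamily

variable {V : ℝ → ℝ} (F : FundamentalFamily l V) (hV : IntegrableOn V (Icc 0 l))
include F hV

-- Along `k_n = (a + 2πn) / t` the function `k S(k²)` tends to `sin a`.
lemma exists_tendsto_atTop_mul_sin (ht : t ∈ Ioc (0 : ℝ) l) (a : ℝ) :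
    ∃ k : ℕ → ℝ, Tendsto k atTop atTop ∧
      Tendsto (fun n => k n * F.sin (k n ^ 2) t) atTop (𝓝 (Real.sin a)) := by
  let k (n : ℕ) : ℝ := (a + n * (2 * Real.pi)) / t
  have hk : Tendsto k atTop atTop := (tendsto_atTop_add_const_left _ a
    (tendsto_natCast_atTop_atTop.atTop_mul_const (by positivity))).atTop_div_const ht.1
  have hsin (n : ℕ) : Real.sin (k n * t) = Real.sin a := by
    rw [div_mul_cancel₀ _ ht.1.ne', Real.sin_add_nat_mul_two_pi]
  refine ⟨k, hk, ?_⟩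
  simpa [hsin] using
    ((F.tendsto_mul_sin_sub hV (Ioc_subset_Icc_self ht)).comp hk).add_const (Real.sin a)

lemma exists_sin_eq_zero_gt (ht : t ∈ Ioc (0 : ℝ) l) (X : ℝ) : ∃ x > X, F.sin x t = 0 := by
  have hsq : Tendsto (fun k : ℝ => k ^ 2) atTop atTop := tendsto_pow_atTop two_ne_zero
  refine exists_zero_gt_of_frequently_pos_of_frequently_neg
    (F.continuous_sin (Ioc_subset_Icc_self ht)) ?_ ?_ X
  · obtain ⟨k, hk, hlim⟩ := F.exists_tendsto_atTop_mul_sin hV ht (Real.pi / 2)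
    rw [Real.sin_pi_div_two] at hlim
    refine (hsq.comp hk).frequently (Eventually.frequently ?_)
    filter_upwards [hlim.eventually_const_lt zero_lt_one, hk.eventually_gt_atTop 0] with n hn hkn
    exact pos_of_mul_pos_right hn hkn.le
  · obtain ⟨k, hk, hlim⟩ := F.exists_tendsto_atTop_mul_sin hV ht (-(Real.pi / 2))
    rw [Real.sin_neg, Real.sin_pi_div_two] at hlim
    refine (hsq.comp hk).frequently (Eventually.frequently ?_)
    filter_upwards [hlim.eventually_lt_const neg_one_lt_zero, hk.eventually_gt_atTop 0]
      with n hn hkn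
    exact neg_of_mul_neg_right hn hkn.le

lemma eventually_norm_sub_hyperbolic_le (ht : t ∈ Icc (0 : ℝ) l) :
    ∀ᶠ κ : ℝ in atTop,
      ‖κ * F.sin (-κ ^ 2) t - Real.sinh (κ * t)‖ ≤
        2 * (∫ t in (0 : ℝ)..l, ‖V t‖) / κ * Real.exp (κ * t) ∧
      ‖F.sinDeriv (-κ ^ 2) t - Real.cosh (κ * t)‖ ≤
        2 * (∫ t in (0 : ℝ)..l, ‖V t‖) / κ * Real.exp (κ * t) ∧
      ‖F.cos (-κ ^ 2) t - Real.cosh (κ * t)‖ ≤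
        2 * (∫ t in (0 : ℝ)..l, ‖V t‖) / κ * Real.exp (κ * t) := by
  filter_upwards [eventually_gt_atTop 0, eventually_ge_atTop (2 * ∫ t in (0 : ℝ)..l, ‖V t‖)]
    with κ hκ hκV
  have hnorm : ‖(κ * Complex.I : ℂ)‖ = κ := by simp [abs_of_pos hκ]
  have him : |(κ * Complex.I : ℂ).im| = κ := by simp [abs_of_pos hκ]
  obtain ⟨hs, hs', hc⟩ := F.norm_sub_free_le hV (k := κ * Complex.I) (x := -κ ^ 2)
    (by push_cast; rw [mul_pow, Complex.I_sq, mul_neg_one]) (by simpa using hκ.ne')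
    (by rwa [hnorm]) ht
  have hcos : Complex.cos (κ * Complex.I * t) = (Real.cosh (κ * t) : ℝ) := by
    rw [mul_right_comm, Complex.cos_mul_I]
    push_cast
    rfl
  have hsin : (F.sin (-κ ^ 2) t : ℂ) - Complex.sin (κ * Complex.I * t) / (κ * Complex.I) =
      ((F.sin (-κ ^ 2) t - Real.sinh (κ * t) / κ : ℝ) : ℂ) := by
    rw [mul_right_comm, Complex.sin_mul_I, mul_div_mul_right _ _ Complex.I_ne_zero]
    push_cast
    rfl
  rw [hsin, hnorm, him, Complex.norm_real] at hs
  rw [hcos, hnorm, him, ← Complex.ofReal_sub, Complex.norm_real] at hs' hc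
  refine ⟨?_, hs', hc⟩
  calc ‖κ * F.sin (-κ ^ 2) t - Real.sinh (κ * t)‖
      = κ * ‖F.sin (-κ ^ 2) t - Real.sinh (κ * t) / κ‖ := by
        rw [← Real.norm_of_nonneg hκ.le, ← norm_mul, Real.norm_of_nonneg hκ.le, mul_sub,
          mul_div_cancel₀ _ hκ.ne']
    _ ≤ κ * (2 * (∫ t in (0 : ℝ)..l, ‖V t‖) / κ ^ 2 * Real.exp (κ * t)) := by gcongr
    _ = 2 * (∫ t in (0 : ℝ)..l, ‖V t‖) / κ * Real.exp (κ * t) := by field_simp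

lemma tendsto_exp_neg_mul (ht : t ∈ Ioc (0 : ℝ) l) :
    Tendsto (fun κ => Real.exp (-(κ * t)) * (κ * F.sin (-κ ^ 2) t)) atTop (𝓝 (1 / 2)) ∧
      Tendsto (fun κ => Real.exp (-(κ * t)) * F.sinDeriv (-κ ^ 2) t) atTop (𝓝 (1 / 2)) ∧
      Tendsto (fun κ => Real.exp (-(κ * t)) * F.cos (-κ ^ 2) t) atTop (𝓝 (1 / 2)) := by
  have h := F.eventually_norm_sub_hyperbolic_le hV (Ioc_subset_Icc_self ht)
  obtain ⟨hsinh, hcosh⟩ := tendsto_exp_neg_mul_hyperbolic ht.1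
  exact ⟨tendsto_exp_neg_mul_of_norm_sub_le hsinh (h.mono fun _ h => h.1),
    tendsto_exp_neg_mul_of_norm_sub_le hcosh (h.mono fun _ h => h.2.1),
    tendsto_exp_neg_mul_of_norm_sub_le hcosh (h.mono fun _ h => h.2.2)⟩

lemma eventually_sin_pos_atBot (ht : t ∈ Ioc (0 : ℝ) l) : ∀ᶠ x in atBot, 0 < F.sin x t := by
  rw [eventually_atBot_iff_neg_sq]
  filter_upwards [(F.tendsto_exp_neg_mul hV ht).1.eventually_const_lt one_half_pos,
    eventually_gt_atTop 0] with κ h hκ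
  exact pos_of_mul_pos_right (pos_of_mul_pos_right h (Real.exp_pos _).le) hκ.le

omit hV in
/-- The function `η` of the theorem on the real axis, with the length `l` replaced by `t`. -/
def discriminant (α β t x : ℝ) : ℝ :=
  (1 + β ^ 2) * (F.sinDeriv x t + F.cos x t) + α * F.sin x t

omit hV in
lemma continuous_discriminant (ht : t ∈ Icc (0 : ℝ) l) (α β : ℝ) :
    Continuous (F.discriminant α β t) :=
  (((F.continuous_sinDeriv ht).add (F.continuous_cos ht)).const_mul _).add
    ((F.continuous_sin ht).const_mul _)

lemma tendsto_discriminant_atBot (ht : t ∈ Ioc (0 : ℝ) l) (α β : ℝ) :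
    Tendsto (F.discriminant α β t) atBot atTop := by
  obtain ⟨hs, hs', hc⟩ := F.tendsto_exp_neg_mul hV ht
  have hη : Tendsto (fun κ => Real.exp (-(κ * t)) * F.discriminant α β t (-κ ^ 2)) atTop
      (𝓝 (1 + β ^ 2)) := by
    have hlim := ((hs'.add hc).const_mul (1 + β ^ 2)).add
      ((tendsto_inv_atTop_zero.mul hs).const_mul α)
    simp only [add_halves, mul_one, zero_mul, mul_zero, add_zero] at hlim
    refine hlim.congr' ?_
    filter_upwards [eventually_ne_atTop 0] with κ hκ
    rw [discriminant]
    field_simp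
  have htop : Tendsto (fun κ => F.discriminant α β t (-κ ^ 2)) atTop atTop := by
    refine ((Real.tendsto_exp_atTop.comp (tendsto_id.atTop_mul_const ht.1)).atTop_mul_pos
      (by positivity) hη).congr fun κ => ?_
    simp only [Function.comp, id, ← mul_assoc, ← Real.exp_add, add_neg_cancel, Real.exp_zero,
      one_mul]
  exact tendsto_atTop.2 fun b => eventually_atBot_iff_neg_sq.2 (htop.eventually_ge_atTop b)

end FundamentalFamily

end Asymptotics

/-! ### Level sets between consecutive zeros -/

section Zeros

open Filter Topology

variable {f d η : ℝ → ℝ} {T : Set ℝ} {B σ μ ν : ℝ}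

lemma mul_pos_of_forall_ne_zero {s : Set ℝ} (hs : IsPreconnected s) (hf : ContinuousOn f s)
    (hne : ∀ x ∈ s, f x ≠ 0) {x y : ℝ} (hx : x ∈ s) (hy : y ∈ s) : 0 < f x * f y := by
  by_contra! hle
  have hzero : (0 : ℝ) ∈ f '' s := by
    rcases mul_nonpos_iff.1 hle with h | h
    · exact hs.intermediate_value hy hx hf ⟨h.2, h.1⟩
    · exact hs.intermediate_value hx hy hf h
  obtain ⟨z, hz, hfz⟩ := hzero
  exact hne z hz hfz

lemma exists_next_zero (hf : Continuous f) (hμ : ∀ᶠ y in 𝓝[>] μ, f y ≠ 0)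
    (h : ∃ z > μ, f z = 0) : ∃ ν > μ, f ν = 0 ∧ ∀ y ∈ Ioo μ ν, f y ≠ 0 := by
  obtain ⟨z, hz, hfz⟩ := h
  obtain ⟨ρ, hρ, hne⟩ := (mem_nhdsGT_iff_exists_Ioo_subset' hz).1 hμ
  have hge (y : ℝ) (hy : μ < y) (hfy : f y = 0) : ρ ≤ y := not_lt.1 fun hlt => hne ⟨hy, hlt⟩ hfy
  obtain ⟨ν, ⟨⟨hρν, hνz⟩, hfν⟩, hleast⟩ :=
    (isCompact_Icc.inter_right (isClosed_singleton.preimage hf)).exists_isLeast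
      (⟨z, ⟨hge z hz hfz, le_rfl⟩, hfz⟩ : (Icc ρ z ∩ f ⁻¹' {0}).Nonempty)
  exact ⟨ν, lt_of_lt_of_le hρ hρν, hfν, fun y hy hfy =>
    hy.2.not_ge (hleast ⟨⟨hge y hy.1 hfy, hy.2.le.trans hνz⟩, hfy⟩)⟩

lemma exists_previous_zero (hf : Continuous f) (hμ : ∀ᶠ y in 𝓝[<] μ, f y ≠ 0)
    (h : ∃ z < μ, f z = 0) : ∃ ν < μ, f ν = 0 ∧ ∀ y ∈ Ioo ν μ, f y ≠ 0 := by
  obtain ⟨z, hz, hfz⟩ := h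
  have hneg : Tendsto (fun y : ℝ => -y) (𝓝[>] (-μ)) (𝓝[<] μ) := by
    simpa using tendsto_neg_nhdsGT (a := -μ)
  obtain ⟨ν, hν, hfν, hne⟩ := exists_next_zero (f := fun y => f (-y)) (by fun_prop)
    (hneg.eventually hμ) ⟨-z, neg_lt_neg hz, by simpa⟩
  refine ⟨-ν, neg_lt.1 hν, hfν, fun y hy => ?_⟩
  simpa using hne (-y) ⟨neg_lt_neg hy.2, neg_lt.1 hy.1⟩

/-- `d` has the sign of the derivative of `f` at the zeros of `f`, without any differentiability
being required: near a zero `x`, `f` has the sign of `d x * (y - x)`. -/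
def IsSignDeriv (f d : ℝ → ℝ) : Prop :=
  ∀ x, f x = 0 → ∀ᶠ y in 𝓝[≠] x, 0 < (y - x) * (d x * f y)

namespace IsSignDeriv

variable (h : IsSignDeriv f d)
include h

lemma eventually_pos_right (hμ : f μ = 0) : ∀ᶠ y in 𝓝[>] μ, 0 < d μ * f y := by
  filter_upwards [nhdsGT_le_nhdsNE μ (h μ hμ), self_mem_nhdsWithin] with y hy hμy
  exact pos_of_mul_pos_right hy (sub_nonneg.2 (le_of_lt hμy))

lemma eventually_neg_left (hμ : f μ = 0) : ∀ᶠ y in 𝓝[<] μ, d μ * f y < 0 := by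
  filter_upwards [nhdsLT_le_nhdsNE μ (h μ hμ), self_mem_nhdsWithin] with y hy hμy
  exact neg_of_mul_pos_right hy (sub_nonpos.2 (le_of_lt hμy))

lemma mul_neg_of_adjacent (hf : Continuous f) (hμν : μ < ν) (hμ : f μ = 0) (hν : f ν = 0)
    (hne : ∀ y ∈ Ioo μ ν, f y ≠ 0) : d μ * d ν < 0 := by
  obtain ⟨x, hx, hxμν⟩ := ((h.eventually_pos_right hμ).and (Ioo_mem_nhdsGT hμν)).exists
  obtain ⟨y, hy, hyμν⟩ := ((h.eventually_neg_left hν).and (Ioo_mem_nhdsLT hμν)).exists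
  have hxy := mul_pos_of_forall_ne_zero isPreconnected_Ioo hf.continuousOn hne hxμν hyμν
  refine neg_of_mul_neg_left (b := f x * f y) ?_ hxy.le
  calc d μ * d ν * (f x * f y) = (d μ * f x) * (d ν * f y) := by ring
    _ < 0 := mul_neg_of_pos_of_neg hx hy

lemma neg_of_first_zero (hf : Continuous f) (hbot : ∀ᶠ x in atBot, 0 < f x) (hμ : f μ = 0)
    (hne : ∀ y < μ, f y ≠ 0) : d μ < 0 := by
  obtain ⟨x, hx, hxμ⟩ := (hbot.and (eventually_lt_atBot μ)).exists
  obtain ⟨y, hy, hyμ⟩ := ((h.eventually_neg_left hμ).and self_mem_nhdsWithin).exists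
  have hfy := mul_pos_of_forall_ne_zero isPreconnected_Iio hf.continuousOn hne hxμ hyμ
  exact neg_of_mul_neg_left hy (pos_of_mul_pos_right hfy hx.le).le

variable (hf : Continuous f) (hη : Continuous η) (hpos : ∀ x, f x = 0 → 0 < d x → B ≤ η x)
  (hneg : ∀ x, f x = 0 → d x < 0 → η x ≤ -B) (hσ : |σ| < B)
include hf hη hpos hneg hσ

lemma exists_level_of_adjacent (hμν : μ < ν) (hμ : f μ = 0) (hν : f ν = 0)
    (hne : ∀ y ∈ Ioo μ ν, f y ≠ 0) : ∃ a ∈ Ioo μ ν, η a = σ := by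
  obtain ⟨hσ₁, hσ₂⟩ := abs_lt.1 hσ
  rcases mul_neg_iff.1 (h.mul_neg_of_adjacent hf hμν hμ hν hne) with ⟨hdμ, hdν⟩ | ⟨hdμ, hdν⟩
  · exact intermediate_value_Ioo' hμν.le hη.continuousOn
      ⟨(hneg ν hν hdν).trans_lt hσ₁, hσ₂.trans_le (hpos μ hμ hdμ)⟩
  · exact intermediate_value_Ioo hμν.le hη.continuousOn
      ⟨(hneg μ hμ hdμ).trans_lt hσ₁, hσ₂.trans_le (hpos ν hν hdν)⟩

lemma exists_level_above (hμ : f μ = 0) (htop : ∃ z > μ, f z = 0) :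
    ∃ b > μ, η b = σ ∧ ∀ y ∈ Ioc μ b, f y ≠ 0 := by
  obtain ⟨ν, hμν, hν, hne⟩ := exists_next_zero hf
    ((h.eventually_pos_right hμ).mono fun y hy => right_ne_zero_of_mul hy.ne') htop
  obtain ⟨b, hb, hbσ⟩ := h.exists_level_of_adjacent hf hη hpos hneg hσ hμν hμ hν hne
  exact ⟨b, hb.1, hbσ, fun y hy => hne y ⟨hy.1, hy.2.trans_lt hb.2⟩⟩

lemma exists_level_below (hbot : ∀ᶠ x in atBot, 0 < f x) (hηbot : Tendsto η atBot atTop)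
    (hμ : f μ = 0) : ∃ a < μ, η a = σ ∧ ∀ y ∈ Ico a μ, f y ≠ 0 := by
  by_cases hz : ∃ z < μ, f z = 0
  · obtain ⟨ν, hνμ, hν, hne⟩ := exists_previous_zero hf
      ((h.eventually_neg_left hμ).mono fun y hy => right_ne_zero_of_mul hy.ne) hz
    obtain ⟨a, ha, haσ⟩ := h.exists_level_of_adjacent hf hη hpos hneg hσ hνμ hν hμ hne
    exact ⟨a, ha.2, haσ, fun y hy => hne y ⟨ha.1.trans_le hy.1, hy.2⟩⟩
  · push Not at hz
    obtain ⟨x, hxσ, hxμ⟩ := ((hηbot.eventually_gt_atTop σ).and (eventually_lt_atBot μ)).exists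
    have hημ := hneg μ hμ (h.neg_of_first_zero hf hbot hμ hz)
    obtain ⟨a, ha, haσ⟩ := intermediate_value_Ioo' hxμ.le hη.continuousOn
      (show σ ∈ Ioo (η μ) (η x) from ⟨hημ.trans_lt (abs_lt.1 hσ).1, hxσ⟩)
    exact ⟨a, ha.2, haσ, fun y hy => hz y hy.2⟩

end IsSignDeriv

lemma exists_isGap_of_isClosed (hT : IsClosed T) {a₀ b₀ : ℝ} (ha : a₀ < μ) (hb : μ < b₀)
    (haT : a₀ ∈ T) (hbT : b₀ ∈ T) (hμ : μ ∉ T) :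
    ∃ a b, IsGap T a b ∧ μ ∈ Ioo a b ∧ a₀ ≤ a ∧ b ≤ b₀ := by
  obtain ⟨a, ⟨⟨ha₁, ha₂⟩, haT'⟩, hgreatest⟩ := (isCompact_Icc.inter_right hT).exists_isGreatest
    (⟨a₀, ⟨le_rfl, ha.le⟩, haT⟩ : (Icc a₀ μ ∩ T).Nonempty)
  obtain ⟨b, ⟨⟨hb₁, hb₂⟩, hbT'⟩, hleast⟩ := (isCompact_Icc.inter_right hT).exists_isLeast
    (⟨b₀, ⟨hb.le, le_rfl⟩, hbT⟩ : (Icc μ b₀ ∩ T).Nonempty)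
  have haμ : a < μ := ha₂.lt_of_ne fun h => hμ (h ▸ haT')
  have hbμ : μ < b := hb₁.lt_of_ne fun h => hμ (h ▸ hbT')
  refine ⟨a, b, ⟨haμ.trans hbμ, haT', hbT', ?_⟩, ⟨haμ, hbμ⟩, ha₁, hb₂⟩
  refine Set.disjoint_left.2 fun y hy hyT => ?_
  rcases le_total y μ with hyμ | hyμ
  · exact hy.1.not_ge (hgreatest ⟨⟨ha₁.trans hy.1.le, hyμ⟩, hyT⟩)
  · exact hy.2.not_ge (hleast ⟨⟨hyμ, hy.2.le.trans hb₂⟩, hyT⟩)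

lemma IsSignDeriv.exists_isGap (h : IsSignDeriv f d) (hf : Continuous f) (hη : Continuous η)
    (hpos : ∀ x, f x = 0 → 0 < d x → B ≤ η x) (hneg : ∀ x, f x = 0 → d x < 0 → η x ≤ -B)
    (hbot : ∀ᶠ x in atBot, 0 < f x) (hηbot : Tendsto η atBot atTop)
    (htop : ∃ z > μ, f z = 0) (hT : IsClosed T) (hσ : |σ| < B) (hσT : η ⁻¹' {σ} ⊆ T)
    (hμ : f μ = 0) (hμT : μ ∉ T) :
    ∃ a b, IsGap T a b ∧ μ ∈ Ioo a b ∧ ∀ y ∈ Ioo a b, f y = 0 → y = μ := by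
  obtain ⟨a₀, ha₀, ha₀σ, hne₁⟩ := h.exists_level_below hf hη hpos hneg hσ hbot hηbot hμ
  obtain ⟨b₀, hb₀, hb₀σ, hne₂⟩ := h.exists_level_above hf hη hpos hneg hσ hμ htop
  obtain ⟨a, b, hgap, hmem, ha, hb⟩ :=
    exists_isGap_of_isClosed hT ha₀ hb₀ (hσT ha₀σ) (hσT hb₀σ) hμT
  refine ⟨a, b, hgap, hmem, fun y hy hfy => ?_⟩
  by_contra hyμ
  rcases lt_or_gt_of_ne hyμ with hlt | hgt
  · exact hne₁ y ⟨ha.trans hy.1.le, hlt⟩ hfy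
  · exact hne₂ y ⟨hgt, hy.2.le.trans hb⟩ hfy

end Zeros

/-! ### The discrete magnetic Laplacian -/

section Harper

variable {E : Type*} [NormedAddCommGroup E] [InnerProductSpace ℂ E]

/-- The Harper operator `R + R⁻¹ + b (U + U⁻¹)` of two unitaries. The discrete magnetic Laplacian
is the one for magnetic translations, which commute up to the phase given by the flux. -/
def harperOp (R U : E ≃ₗᵢ[ℂ] E) (b : ℝ) : E →L[ℂ] E :=
  (R : E →L[ℂ] E) + (R.symm : E →L[ℂ] E) + (b : ℂ) • ((U : E →L[ℂ] E) + (U.symm : E →L[ℂ] E))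

variable (R U : E ≃ₗᵢ[ℂ] E)

lemma harperOp_apply (b : ℝ) (g : E) :
    harperOp R U b g = R g + R.symm g + (b : ℂ) • (U g + U.symm g) := rfl

lemma isSelfAdjoint_harperOp [CompleteSpace E] (b : ℝ) : IsSelfAdjoint (harperOp R U b) := by
  rw [ContinuousLinearMap.isSelfAdjoint_iff_isSymmetric]
  intro g h
  have inner_symm_left (T : E ≃ₗᵢ[ℂ] E) : inner ℂ (T.symm g) h = inner ℂ g (T h) := by
    simpa using T.inner_map_map (T.symm g) h |>.symm
  have inner_left (T : E ≃ₗᵢ[ℂ] E) : inner ℂ (T g) h = inner ℂ g (T.symm h) := by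
    simpa using T.inner_map_map g (T.symm h)
  simp only [ContinuousLinearMap.coe_coe, harperOp_apply, inner_add_left, inner_add_right,
    inner_smul_left, inner_smul_right, inner_symm_left, inner_left, Complex.conj_ofReal]
  ring

lemma norm_add_le_of_mul_le_norm_sub {x y : E} {N δ : ℝ} (hx : ‖x‖ = N) (hy : ‖y‖ = N)
    (hδ : 0 ≤ δ) (h : δ * N ≤ ‖x - y‖) : ‖x + y‖ ≤ √(4 - δ ^ 2) * N := by
  have hN : 0 ≤ N := hx ▸ norm_nonneg x
  have parallelogram := parallelogram_law_with_norm ℂ x y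
  rw [hx, hy] at parallelogram
  have norm_sq_le : ‖x + y‖ ^ 2 ≤ (4 - δ ^ 2) * N ^ 2 := by
    have := mul_self_le_mul_self (by positivity) h
    linarith
  calc ‖x + y‖ = √(‖x + y‖ ^ 2) := (Real.sqrt_sq (norm_nonneg _)).symm
    _ ≤ √((4 - δ ^ 2) * N ^ 2) := Real.sqrt_le_sqrt norm_sq_le
    _ = √(4 - δ ^ 2) * N := by rw [Real.sqrt_mul' _ (sq_nonneg N), Real.sqrt_sq hN]

variable {R U} {q : ℂ}

-- `‖R g - U⁻¹ g‖ = ‖U R g - g‖` and `‖U g - R⁻¹ g‖ = ‖R U g - g‖`.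
lemma norm_one_sub_mul_norm_le_of_comm (hq : ∀ g, U (R g) = q • R (U g)) (g : E) :
    ‖1 - q‖ * ‖g‖ ≤ ‖R g - U.symm g‖ + ‖U g - R.symm g‖ := by
  have hUR : ‖R g - U.symm g‖ = ‖U (R g) - g‖ := by
    rw [← U.norm_map, map_sub, U.apply_symm_apply]
  have hRU : ‖U g - R.symm g‖ = ‖R (U g) - g‖ := by
    rw [← R.norm_map, map_sub, R.apply_symm_apply]
  calc ‖1 - q‖ * ‖g‖ = ‖(1 - q) • R (U g)‖ := by rw [norm_smul, R.norm_map, U.norm_map]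
    _ = ‖(R (U g) - g) - (U (R g) - g)‖ := by rw [hq, sub_smul, one_smul, sub_sub_sub_cancel_right]
    _ ≤ ‖R (U g) - g‖ + ‖U (R g) - g‖ := norm_sub_le _ _
    _ = _ := by rw [hUR, hRU, add_comm]

lemma norm_add_symm_add_norm_add_symm_le (hq : ∀ g, U (R g) = q • R (U g)) (g : E) :
    ‖R g + U.symm g‖ + ‖U g + R.symm g‖ ≤ (2 + √(4 - (‖1 - q‖ / 2) ^ 2)) * ‖g‖ := by
  have hflux := norm_one_sub_mul_norm_le_of_comm hq g
  have hR := norm_add_le (R g) (U.symm g)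
  have hU := norm_add_le (U g) (R.symm g)
  simp only [LinearIsometryEquiv.norm_map] at hR hU
  have hδ : 0 ≤ ‖1 - q‖ / 2 := by positivity
  rcases le_or_gt (‖1 - q‖ / 2 * ‖g‖) ‖R g - U.symm g‖ with h | h
  · linarith [norm_add_le_of_mul_le_norm_sub (R.norm_map g) (U.symm.norm_map g) hδ h]
  · linarith [norm_add_le_of_mul_le_norm_sub (U.norm_map g) (R.symm.norm_map g) hδ (by linarith)]

lemma norm_harperOp_apply_le {b κ : ℝ} (hκ : 0 ≤ κ) (hκ1 : κ ≤ 1) (hκb : κ ≤ b) (g : E) :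
    ‖harperOp R U b g‖ ≤
      κ * (‖R g + U.symm g‖ + ‖U g + R.symm g‖) + 2 * (1 + b - 2 * κ) * ‖g‖ := by
  have hdecomp : harperOp R U b g = ((κ : ℝ) : ℂ) • ((R g + U.symm g) + (U g + R.symm g))
      + (((1 - κ : ℝ) : ℂ) • (R g + R.symm g) + ((b - κ : ℝ) : ℂ) • (U g + U.symm g)) := by
    rw [harperOp_apply]
    push_cast
    module
  have hT (T : E ≃ₗᵢ[ℂ] E) {t : ℝ} (ht : 0 ≤ t) : ‖(t : ℂ) • (T g + T.symm g)‖ ≤ t * (2 * ‖g‖) := by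
    rw [norm_smul, Complex.norm_of_nonneg ht]
    gcongr
    refine (norm_add_le _ _).trans_eq ?_
    rw [T.norm_map, T.symm.norm_map, two_mul]
  have hpair : ‖((κ : ℝ) : ℂ) • ((R g + U.symm g) + (U g + R.symm g))‖ ≤
      κ * (‖R g + U.symm g‖ + ‖U g + R.symm g‖) := by
    rw [norm_smul, Complex.norm_of_nonneg hκ]
    gcongr
    exact norm_add_le _ _
  rw [hdecomp]
  refine (norm_add_le _ _).trans ((add_le_add hpair ((norm_add_le _ _).trans
    (add_le_add (hT R (sub_nonneg.2 hκ1)) (hT U (sub_nonneg.2 hκb))))).trans_eq ?_)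
  ring

theorem norm_harperOp_lt (hq : ∀ g, U (R g) = q • R (U g)) (hq1 : q ≠ 1) {b : ℝ} (hb : 0 < b) :
    ‖harperOp R U b‖ < 2 * (1 + b) := by
  set ρ := √(4 - (‖1 - q‖ / 2) ^ 2)
  have hρ0 : 0 ≤ ρ := Real.sqrt_nonneg _
  have hρ : ρ < 2 := by
    have : 0 < ‖1 - q‖ := norm_pos_iff.2 (sub_ne_zero.2 hq1.symm)
    rw [Real.sqrt_lt' two_pos]
    nlinarith
  obtain ⟨κ, hκ, hκ1, hκb⟩ : ∃ κ > 0, κ ≤ 1 ∧ κ ≤ b :=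
    ⟨min 1 b, lt_min one_pos hb, min_le_left _ _, min_le_right _ _⟩
  have hbound : ‖harperOp R U b‖ ≤ 2 * (1 + b) - κ * (2 - ρ) := by
    refine ContinuousLinearMap.opNorm_le_bound _ (by nlinarith) fun g => ?_
    have := mul_le_mul_of_nonneg_left (norm_add_symm_add_norm_add_symm_le hq g) hκ.le
    linarith [norm_harperOp_apply_le (R := R) (U := U) hκ.le hκ1 hκb g]
  nlinarith

end Harper

section Discrete

lemma phase_add (x y : ℝ) : phase (x + y) = phase x * phase y := by
  simp only [phase, ← Complex.exp_add]
  push_cast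
  ring_nf

lemma phase_mul_phase_neg (x : ℝ) : phase x * phase (-x) = 1 := by
  rw [← phase_add, add_neg_cancel, phase]
  simp

lemma phase_neg_mul_phase (x : ℝ) : phase (-x) * phase x = 1 := by
  rw [mul_comm, phase_mul_phase_neg]

lemma phase_two_mul_ne_one {θ : ℝ} (hθ : ∀ k : ℤ, θ ≠ k) : phase (2 * θ) ≠ 1 := by
  intro h
  obtain ⟨k, hk⟩ := Complex.exp_eq_one_iff.1 h
  have : (2 * Real.pi * Complex.I : ℂ) * θ = 2 * Real.pi * Complex.I * k := by
    push_cast at hk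
    linear_combination hk
  exact hθ k (by exact_mod_cast mul_left_cancel₀ Complex.two_pi_I_ne_zero this)

lemma magneticShift_apply (σ : ℤ × ℤ ≃ ℤ × ℤ) (x : ℤ × ℤ → ℝ) (g : NodeL2) (i : ℤ × ℤ) :
    magneticShift σ x g i = phase (x i) * g (σ i) := rfl

lemma norm_magneticShift (σ : ℤ × ℤ ≃ ℤ × ℤ) (x : ℤ × ℤ → ℝ) (g : NodeL2) :
    ‖magneticShift σ x g‖ = ‖g‖ := by
  rw [lp.norm_eq_tsum_rpow (by norm_num), lp.norm_eq_tsum_rpow (by norm_num),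
    ← σ.tsum_eq fun i => ‖g i‖ ^ (2 : ENNReal).toReal]
  simp only [magneticShift_apply, norm_mul, phase_norm, one_mul]

/-- `magneticShift σ x` as a unitary of `ℓ²(ℤ²)`. -/
def magneticShiftEquiv (σ : ℤ × ℤ ≃ ℤ × ℤ) (x : ℤ × ℤ → ℝ) : NodeL2 ≃ₗᵢ[ℂ] NodeL2 where
  __ := magneticShift σ x
  invFun := magneticShift σ.symm fun i => -x (σ.symm i)
  left_inv g := by
    ext i
    simp [magneticShift_apply, ← mul_assoc, phase_neg_mul_phase]
  right_inv g := by
    ext i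
    simp [magneticShift_apply, ← mul_assoc, phase_mul_phase_neg]
  norm_map' := norm_magneticShift σ x

variable (θ β : ℝ)

/-- The magnetic translation by `(1, 0)`. -/
def shiftRight : NodeL2 ≃ₗᵢ[ℂ] NodeL2 :=
  magneticShiftEquiv (translate 1 0) fun i => i.2 * θ

/-- The magnetic translation by `(0, 1)`. -/
def shiftUp : NodeL2 ≃ₗᵢ[ℂ] NodeL2 :=
  magneticShiftEquiv (translate 0 1) fun i => -(i.1 * θ)

lemma shiftRight_apply (g : NodeL2) (m n : ℤ) :
    shiftRight θ g (m, n) = phase (n * θ) * g (m + 1, n) := by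
  change phase (n * θ) * g (m + 1, n + 0) = _
  rw [add_zero]

lemma shiftUp_apply (g : NodeL2) (m n : ℤ) :
    shiftUp θ g (m, n) = phase (-(m * θ)) * g (m, n + 1) := by
  change phase (-(m * θ)) * g (m + 0, n + 1) = _
  rw [add_zero]

lemma shiftRight_symm_apply (g : NodeL2) (m n : ℤ) :
    (shiftRight θ).symm g (m, n) = phase (-(n * θ)) * g (m - 1, n) := by
  change phase (-((n + -0 : ℤ) * θ)) * g (m + -1, n + -0) = _
  rw [neg_zero, add_zero, sub_eq_add_neg]

lemma shiftUp_symm_apply (g : NodeL2) (m n : ℤ) :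
    (shiftUp θ).symm g (m, n) = phase (m * θ) * g (m, n - 1) := by
  change phase (- -((m + -0 : ℤ) * θ)) * g (m + -0, n + -1) = _
  rw [neg_zero, add_zero, neg_neg, sub_eq_add_neg]

lemma shiftUp_shiftRight (g : NodeL2) :
    shiftUp θ (shiftRight θ g) = phase (2 * θ) • shiftRight θ (shiftUp θ g) := by
  ext ⟨m, n⟩
  rw [lp.coeFn_smul, Pi.smul_apply, smul_eq_mul, shiftUp_apply, shiftRight_apply,
    shiftRight_apply, shiftUp_apply]
  have hphase : phase (-(m * θ)) * phase ((n + 1 : ℤ) * θ) =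
      phase (2 * θ) * (phase (n * θ) * phase (-((m + 1 : ℤ) * θ))) := by
    simp only [← phase_add]
    congr 1
    push_cast
    ring
  linear_combination (g (m + 1, n + 1)) * hphase

lemma discreteLaplacian_eq_harperOp :
    discreteLaplacian θ β = harperOp (shiftRight θ) (shiftUp θ) (β ^ 2) := by
  ext g ⟨m, n⟩
  simp only [discreteLaplacian_apply, harperOp_apply, lp.coeFn_add, lp.coeFn_smul, Pi.add_apply,
    Pi.smul_apply, smul_eq_mul, shiftRight_apply, shiftRight_symm_apply, shiftUp_apply,
    shiftUp_symm_apply, Complex.ofReal_pow]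

instance : Nontrivial NodeL2 :=
  ⟨lp.single 2 (0, 0) 1, 0, fun h => by simpa using congrArg (fun g : NodeL2 => g (0, 0)) h⟩

lemma exists_real_mem_spectrum_discreteLaplacian :
    ∃ σ : ℝ, (σ : ℂ) ∈ spectrum ℂ (discreteLaplacian θ β) := by
  have hself : IsSelfAdjoint (discreteLaplacian θ β) :=
    discreteLaplacian_eq_harperOp θ β ▸ isSelfAdjoint_harperOp _ _ _
  obtain ⟨z, hz⟩ := spectrum.nonempty (discreteLaplacian θ β)
  exact ⟨z.re, by rwa [← hself.mem_spectrum_eq_re hz]⟩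

theorem norm_discreteLaplacian_lt {θ β : ℝ} (hβ : β ≠ 0) (hθ : ∀ k : ℤ, θ ≠ k) :
    ‖discreteLaplacian θ β‖ < 2 * (1 + β ^ 2) :=
  discreteLaplacian_eq_harperOp θ β ▸
    norm_harperOp_lt (shiftUp_shiftRight θ) (phase_two_mul_ne_one hθ) (by positivity)

end Discrete

/-! ### The equation on one edge in `L²[0,l]` -/

section EdgeEquation

variable {l : ℝ} {V : ℝ → ℝ} {z : ℂ} {f g k : EdgeL2 l} {u v w : ℝ → ℂ}

lemma memLp_of_continuousOn {E : Type*} [NormedAddCommGroup E] {u : ℝ → E}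
    (hu : ContinuousOn u (Icc 0 l)) (p : ENNReal) : MemLp u p (edgeMeasure l) := by
  obtain ⟨K, hK⟩ := isCompact_Icc.exists_bound_of_continuousOn hu
  refine MemLp.of_bound (hu.aestronglyMeasurable_of_isCompact isCompact_Icc measurableSet_Icc) K ?_
  filter_upwards [ae_restrict_mem measurableSet_Icc] with t ht using hK t ht

lemma integrableOn_coeFn (k : EdgeL2 l) : IntegrableOn k (Icc 0 l) :=
  (Lp.memLp k).integrable (by norm_num)

lemma IsH2.isSol {q r : ℝ → ℂ} (hl : 0 ≤ l) (h : IsH2 l u v w)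
    (hw : ∀ᵐ t ∂(edgeMeasure l), w t = q t * u t - r t) : IsSol l q r u v where
  fst := ⟨hl, h.continuousOn_fst.integrableOn_compact isCompact_Icc, h.fun_eq⟩
  snd := IsPrimitive.congr_ae (f' := w) ⟨hl, h.memLp.integrable (by norm_num), h.deriv_eq⟩ hw

lemma Represents.isSol (hl : 0 ≤ l) (h : Represents l V f g u v w) (z : ℂ) :
    IsSol l (fun t => V t - z) (g - z • f : EdgeL2 l) u v := by
  refine h.isH2.isSol hl ?_
  filter_upwards [h.left, h.right, Lp.coeFn_sub g (z • f), Lp.coeFn_smul z f] with t hf hg hsub hz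
  rw [hsub, Pi.sub_apply, hz, Pi.smul_apply, hf, hg, smul_eq_mul]
  ring

lemma IsSol.isH2 {r : ℝ → ℂ} (hV : MemLp V 2 (edgeMeasure l)) (hr : MemLp r 2 (edgeMeasure l))
    (h : IsSol l (fun t => V t - z) r u v) : IsH2 l u v fun t => (V t - z) * u t - r t := by
  have hVz : MemLp (fun t => (V t : ℂ) - z) 2 (edgeMeasure l) := hV.ofReal.sub (memLp_const z)
  have hu := memLp_of_continuousOn h.fst.continuousOn ⊤
  exact ⟨(hu.mul (r := 2) hVz).sub hr, h.snd.eq, h.fst.eq⟩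

lemma IsSol.represents (hV : MemLp V 2 (edgeMeasure l)) (h : IsSol l (fun t => V t - z) k u v)
    (hf : f =ᵐ[edgeMeasure l] u) :
    Represents l V f (k + z • f) u v fun t => (V t - z) * u t - k t where
  isH2 := h.isH2 hV (Lp.memLp k)
  left := hf
  right := by
    filter_upwards [hf, Lp.coeFn_add k (z • f), Lp.coeFn_smul z f] with t hf hadd hz
    rw [hadd, Pi.add_apply, hz, Pi.smul_apply, hf, smul_eq_mul]
    ring

lemma Represents.zero_at_ends (hl : 0 < l) (h : Represents l V 0 g u v w) : u 0 = 0 ∧ u l = 0 := by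
  have hu := eq_zero_of_ae hl h.isH2.continuousOn
    (h.left.symm.trans (Lp.coeFn_zero _ _ _))
  exact ⟨hu 0 (left_mem_Icc.2 hl.le), hu l (right_mem_Icc.2 hl.le)⟩

lemma exists_integral_clm {ψ : ℝ → ℂ} (hψ : ContinuousOn ψ (Icc 0 l)) {t : ℝ}
    (ht : t ∈ Icc (0 : ℝ) l) :
    ∃ I : EdgeL2 l →L[ℂ] ℂ, ∀ k, I k = ∫ r in (0 : ℝ)..t, k r * ψ r := by
  have hmem : MemLp ((Ioc 0 t).indicator fun r => starRingEnd ℂ (ψ r)) 2 (edgeMeasure l) :=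
    (memLp_of_continuousOn (Complex.continuous_conj.comp_continuousOn hψ) 2).indicator
      measurableSet_Ioc
  refine ⟨innerSL ℂ hmem.toLp, fun k => ?_⟩
  rw [innerSL_apply_apply, L2.inner_def, intervalIntegral.integral_of_le ht.1,
    ← Measure.restrict_restrict_of_subset (s := Ioc 0 t) (t := Icc 0 l)
      (Ioc_subset_Icc_self.trans (Icc_subset_Icc_right ht.2)),
    ← integral_indicator measurableSet_Ioc]
  refine integral_congr_ae ?_
  filter_upwards [hmem.coeFn_toLp] with r hr
  by_cases hrt : r ∈ Ioc 0 t <;> simp [hr, hrt]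

-- The pointwise bounds are uniform by Banach-Steinhaus.
lemma exists_clm_ae_eq {E : Type*} [NormedAddCommGroup E] [NormedSpace ℂ E] [CompleteSpace E]
    (A : Icc (0 : ℝ) l → E →L[ℂ] ℂ) {u : E → ℝ → ℂ}
    (hu : ∀ k, ContinuousOn (u k) (Icc 0 l)) (hA : ∀ t k, A t k = u k t) :
    ∃ P : E →L[ℂ] EdgeL2 l, ∀ k, P k =ᵐ[edgeMeasure l] u k := by
  obtain ⟨K, hK⟩ : ∃ K, ∀ t, ‖A t‖ ≤ K := banach_steinhaus fun k => by
    obtain ⟨C, hC⟩ := isCompact_Icc.exists_bound_of_continuousOn (hu k)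
    exact ⟨C, fun t => hA t k ▸ hC t t.2⟩
  have hmem (k : E) : MemLp (u k) 2 (edgeMeasure l) := memLp_of_continuousOn (hu k) 2
  let P : E →ₗ[ℂ] EdgeL2 l :=
    { toFun := fun k => (hmem k).toLp
      map_add' := fun k k' => by
        rw [← MemLp.toLp_add, MemLp.toLp_eq_toLp_iff]
        filter_upwards [ae_restrict_mem measurableSet_Icc] with t ht
        simpa only [hA, Pi.add_apply] using map_add (A ⟨t, ht⟩) k k'
      map_smul' := fun a k => by
        rw [RingHom.id_apply, ← MemLp.toLp_const_smul, MemLp.toLp_eq_toLp_iff]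
        filter_upwards [ae_restrict_mem measurableSet_Icc] with t ht
        simpa only [hA, Pi.smul_apply] using map_smul (A ⟨t, ht⟩) a k }
  refine ⟨P.mkContinuous ((edgeMeasure l).real univ ^ ((2 : ENNReal).toReal⁻¹) * |K|) fun k => ?_,
    fun k => (hmem k).coeFn_toLp⟩
  rw [mul_assoc]
  refine Lp.norm_le_of_ae_bound (by positivity) ?_
  filter_upwards [(hmem k).coeFn_toLp, ae_restrict_mem measurableSet_Icc] with t hkt ht
  change ‖((hmem k).toLp : EdgeL2 l) t‖ ≤ _
  rw [hkt, ← hA ⟨t, ht⟩]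
  exact (A ⟨t, ht⟩).le_of_opNorm_le ((hK _).trans (le_abs_self K)) k

lemma IsFundamental.exists_particular_clm {q c c' s s' : ℝ → ℂ} (h : IsFundamental l q c c' s s') :
    ∃ P : EdgeL2 l →L[ℂ] EdgeL2 l, ∀ k, P k =ᵐ[edgeMeasure l]
      fun t => (c t * ∫ x in (0 : ℝ)..t, k x * s x) - s t * ∫ x in (0 : ℝ)..t, k x * c x := by
  choose S hS using fun t : Icc (0 : ℝ) l => exists_integral_clm h.sin.fst.continuousOn t.2
  choose C hC using fun t : Icc (0 : ℝ) l => exists_integral_clm h.cos.fst.continuousOn t.2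
  exact exists_clm_ae_eq (fun t => c t • S t - s t • C t)
    (fun k => (h.isSol_particular (integrableOn_coeFn k)).fst.continuousOn)
    fun t k => by simp [hS, hC]

end EdgeEquation

section DirichletSolver

variable {l : ℝ} {V : ℝ → ℝ} {z : ℂ}

/-- The solution of the Dirichlet problem `-u'' + V u = z u + k`, `u(0) = a`, `u(l) = b`, on one
edge whose fundamental solutions take the values `c = u₂(l)`, `s = u₁(l)`, `s' = u₁'(l)`: it is
`a • startSol + b • endSol + green k`, and `startSource k`, `endSource k` are what the source `k`
adds to the derivatives `u'(0)`, `u'(l)`. -/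
structure DirichletSolver (l : ℝ) (V : ℝ → ℝ) (z c s s' : ℂ) where
  startSol : EdgeL2 l
  endSol : EdgeL2 l
  green : EdgeL2 l →L[ℂ] EdgeL2 l
  startSource : EdgeL2 l →L[ℂ] ℂ
  endSource : EdgeL2 l →L[ℂ] ℂ
  exists_represents : ∀ (k : EdgeL2 l) (a b : ℂ), ∃ u v w : ℝ → ℂ,
    Represents l V (a • startSol + b • endSol + green k)
      (k + z • (a • startSol + b • endSol + green k)) u v w ∧ u 0 = a ∧ u l = b
  eq_of_represents : ∀ {f g : EdgeL2 l} {u v w : ℝ → ℂ}, Represents l V f g u v w →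
    f = u 0 • startSol + u l • endSol + green (g - z • f)
  deriv_start : ∀ {f g : EdgeL2 l} {u v w : ℝ → ℂ}, Represents l V f g u v w →
    v 0 = (u l - u 0 * c) / s + startSource (g - z • f)
  deriv_end : ∀ {f g : EdgeL2 l} {u v w : ℝ → ℂ}, Represents l V f g u v w →
    v l = (u l * s' - u 0) / s + endSource (g - z • f)

lemma IsFundamental.exists_initialValue_clm {q c c' s s' : ℝ → ℂ}
    (h : IsFundamental l q c c' s s') :
    ∃ (Ec Es : EdgeL2 l) (P : EdgeL2 l →L[ℂ] EdgeL2 l), ∀ (k : EdgeL2 l) (a b : ℂ),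
      (a • Ec + b • Es + P k : EdgeL2 l) =ᵐ[edgeMeasure l] fun t => a * c t + b * s t +
        ((c t * ∫ x in (0 : ℝ)..t, k x * s x) - s t * ∫ x in (0 : ℝ)..t, k x * c x) := by
  obtain ⟨P, hP⟩ := h.exists_particular_clm
  have hc := memLp_of_continuousOn h.cos.fst.continuousOn 2
  have hs := memLp_of_continuousOn h.sin.fst.continuousOn 2
  refine ⟨hc.toLp, hs.toLp, P, fun k a b => ?_⟩
  filter_upwards [Lp.coeFn_add (a • hc.toLp + b • hs.toLp) (P k),
    Lp.coeFn_add (a • hc.toLp) (b • hs.toLp), Lp.coeFn_smul a hc.toLp, Lp.coeFn_smul b hs.toLp,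
    hc.coeFn_toLp, hs.coeFn_toLp, hP k] with t h₁ h₂ h₃ h₄ hct hst hPt
  rw [h₁, Pi.add_apply, h₂, Pi.add_apply, h₃, h₄, Pi.smul_apply, Pi.smul_apply, hct, hst, hPt,
    smul_eq_mul, smul_eq_mul]

lemma IsFundamental.nonempty_dirichletSolver (hV : MemLp V 2 (edgeMeasure l))
    {c c' s s' : ℝ → ℂ} (h : IsFundamental l (fun t => V t - z) c c' s s') (hs : s l ≠ 0) :
    Nonempty (DirichletSolver l V z (c l) (s l) (s' l)) := by
  have hl := h.nonneg
  have hll : l ∈ Icc (0 : ℝ) l := right_mem_Icc.2 hl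
  obtain ⟨Ec, Es, P, hP⟩ := h.exists_initialValue_clm
  obtain ⟨Is, hIs⟩ := exists_integral_clm h.sin.fst.continuousOn hll
  obtain ⟨Ic, hIc⟩ := exists_integral_clm h.cos.fst.continuousOn hll
  let ρ := Ic - (c l / s l) • Is
  have hρ (k : EdgeL2 l) : ρ k = Ic k - c l / s l * Is k := rfl
  have hcomb (k : EdgeL2 l) (a b : ℂ) :
      a • (Ec - (c l / s l) • Es) + b • (s l)⁻¹ • Es + (P + ρ.smulRight Es) k =
        a • Ec + ((b - a * c l) / s l + ρ k) • Es + P k := by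
    rw [add_apply, ContinuousLinearMap.smulRight_apply]
    module
  have hstart {f g : EdgeL2 l} {u v w : ℝ → ℂ} (hr : Represents l V f g u v w) :
      v 0 = (u l - u 0 * c l) / s l + ρ (g - z • f) := by
    rw [hρ, hIs, hIc, (h.eq_fst_and_eq_snd (hr.isSol hl z) hll).1]
    field_simp
    ring
  refine ⟨Ec - (c l / s l) • Es, (s l)⁻¹ • Es, P + ρ.smulRight Es, ρ, -(s l)⁻¹ • Is,
    fun k a b => ?_, fun {f g u v w} hr => ?_, hstart, fun {f g u v w} hr => ?_⟩
  · set d := (b - a * c l) / s l + ρ k with hd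
    have hsol := ((h.cos.const_mul a).add (h.sin.const_mul d)).add
      (h.isSol_particular (integrableOn_coeFn k))
    simp only [mul_zero, zero_add] at hsol
    rw [hcomb, ← hd]
    refine ⟨_, _, _, hsol.represents hV (hP k a d), by simp [h.cos_zero, h.sin_zero], ?_⟩
    rw [← hIs, ← hIc, hd, hρ]
    field_simp
    ring
  · rw [hcomb, ← hstart hr]
    refine Lp.ext (hr.left.trans (Filter.EventuallyEq.trans ?_ (hP _ _ _).symm))
    filter_upwards [ae_restrict_mem measurableSet_Icc] with t ht
    rw [(h.eq_fst_and_eq_snd (hr.isSol hl z) ht).1, add_sub_assoc]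
  · have hlag := (hr.isSol hl z).lagrange h.sin hll
    simp only [h.sin_zero, h.sin_deriv_zero, mul_zero, sub_zero, mul_one] at hlag
    rw [smul_apply, hIs, smul_eq_mul]
    field_simp
    linear_combination -hlag

lemma DirichletSolver.exists_norm_start_le {c s s' : ℂ} (hl : 0 < l)
    (D : DirichletSolver l V z c s s') :
    ∃ K : ℝ, ∀ a b : ℂ, ‖a‖ ≤ K * ‖a • D.startSol + b • D.endSol‖ := by
  let T : ℂ × ℂ →ₗ[ℂ] EdgeL2 l :=
    (LinearMap.toSpanSingleton ℂ _ D.startSol).coprod (LinearMap.toSpanSingleton ℂ _ D.endSol)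
  have hT (a b : ℂ) : T (a, b) = a • D.startSol + b • D.endSol := by simp [T]
  have hker : LinearMap.ker T = ⊥ := by
    rw [LinearMap.ker_eq_bot']
    rintro ⟨a, b⟩ hab
    obtain ⟨u, v, w, h, rfl, rfl⟩ := D.exists_represents 0 a b
    rw [← hT, hab, map_zero, add_zero] at h
    exact Prod.ext_iff.2 (h.zero_at_ends hl)
  obtain ⟨K, -, hK⟩ := T.exists_antilipschitzWith hker
  exact ⟨K, fun a b => hT a b ▸ (norm_fst_le (a, b)).trans (hK.le_mul_norm (map_zero T) _)⟩

end DirichletSolver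

/-! ### The resolvent set -/

section Resolvent

variable {E : Type*} [NormedAddCommGroup E] [NormedSpace ℂ E]

lemma isResolventPoint_iff {T : E →ₗ.[ℂ] E} {z : ℂ} :
    IsResolventPoint T z ↔ ∃ R : E →L[ℂ] E, ∀ p : E × E, p ∈ T.graph ↔ p.1 = R (p.2 - z • p.1) := by
  refine exists_congr fun R => ⟨fun ⟨hright, hleft⟩ p => ⟨fun hp => ?_, fun hp => ?_⟩,
    fun h => ⟨fun g => ?_, fun x => ((h (x, T x)).1 (T.mem_graph x)).symm⟩⟩
  · obtain ⟨x, hx₁, hx₂⟩ := T.mem_graph_iff.1 hp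
    rw [← hx₁, ← hx₂, hleft]
  · obtain ⟨hdom, hT⟩ := hright (p.2 - z • p.1)
    simp only [← hp, sub_left_inj] at hT
    exact T.mem_graph_iff.2 ⟨_, rfl, hT⟩
  · obtain ⟨⟨_, hdom⟩, rfl, hT⟩ := T.mem_graph_iff.1 ((h (R g, g + z • R g)).2 (by simp))
    exact ⟨hdom, by rw [hT, add_sub_cancel_right]⟩

lemma isClosed_realSpec [CompleteSpace E] (T : E →ₗ.[ℂ] E) : IsClosed (realSpec T) := by
  rw [← isOpen_compl_iff, isOpen_iff_mem_nhds]
  intro x hx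
  obtain ⟨R, hR⟩ := isResolventPoint_iff.1 (not_not.1 hx)
  have hnear : ∀ᶠ y : ℝ in nhds x, ‖((y : ℂ) - x) • R‖ < 1 :=
    Continuous.tendsto' (by fun_prop) x 0 (by simp) |>.eventually_lt_const zero_lt_one
  filter_upwards [hnear] with y hy
  obtain ⟨A, hA⟩ := isUnit_one_sub_of_norm_lt_one hy
  let A' := ContinuousLinearEquiv.ofUnit A
  have hA' (f : E) : A' f = f - ((y : ℂ) - x) • R f := DFunLike.congr_fun hA f
  refine not_not.2 (isResolventPoint_iff.2 ⟨A'.symm.toContinuousLinearMap ∘L R, fun p => ?_⟩)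
  -- `p.1 = R (p.2 - x p.1)` says `(1 - (y - x) R) p.1 = R (p.2 - y p.1)`.
  rw [hR, ContinuousLinearMap.comp_apply, ContinuousLinearEquiv.coe_coe,
    ContinuousLinearEquiv.eq_symm_apply, hA', sub_eq_iff_eq_add, ← map_smul, ← map_add]
  congr! 2
  module

end Resolvent

/-! ### Square-summable families -/

section Families

variable {ι κ E F : Type*} [NormedAddCommGroup E] [NormedAddCommGroup F]

lemma memℓp_two_of_norm_le {f : ι → E} {g : ι → F} (hf : Memℓp f 2) (K : ℝ)
    (h : ∀ i, ‖g i‖ ≤ K * ‖f i‖) : Memℓp g 2 :=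
  (hf.norm.const_mul K).mono h

lemma memℓp_two_comp_injective {f : ι → E} (hf : Memℓp f 2) {τ : κ → ι}
    (hτ : Function.Injective τ) : Memℓp (fun i => f (τ i)) 2 := by
  rw [memℓp_gen_iff (by norm_num)] at hf ⊢
  exact hf.comp_injective hτ

lemma memℓp_two_clm [NormedSpace ℂ E] [NormedSpace ℂ F] (A : E →L[ℂ] F)
    (x : lp (fun _ : ι => E) 2) : Memℓp (fun i => A (x i)) 2 :=
  memℓp_two_of_norm_le (lp.memℓp x) ‖A‖ fun i => A.le_opNorm (x i)

lemma memℓp_two_smul_const [NormedSpace ℂ E] {a : ι → ℂ} (ha : Memℓp a 2) (x : E) :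
    Memℓp (fun i => a i • x) 2 :=
  memℓp_two_of_norm_le ha ‖x‖ fun i => by rw [norm_smul, mul_comm]

lemma memℓp_two_edge {f : Edge → E} (hr : Memℓp (fun i : ℤ × ℤ => f (i.1, i.2, Dir.r)) 2)
    (hu : Memℓp (fun i : ℤ × ℤ => f (i.1, i.2, Dir.u)) 2) : Memℓp f 2 := by
  let split : (ℤ × ℤ) ⊕ (ℤ × ℤ) ≃ Edge :=
    { toFun := Sum.elim (fun i => (i.1, i.2, Dir.r)) fun i => (i.1, i.2, Dir.u)
      invFun
        | (m, n, Dir.r) => .inl (m, n)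
        | (m, n, Dir.u) => .inr (m, n)
      left_inv := by rintro (i | i) <;> rfl
      right_inv := by rintro ⟨m, n, _ | _⟩ <;> rfl }
  rw [memℓp_gen_iff (by norm_num)] at hr hu ⊢
  exact split.summable_iff.1 (Summable.sum _ hr hu)

-- Continuity is the closed graph theorem.
lemma exists_clm_of_memℓp_two [NormedSpace ℂ E] [CompleteSpace E] [NormedSpace ℂ F]
    [CompleteSpace F] (T : ι → E →L[ℂ] F) (hT : ∀ x, Memℓp (fun i => T i x) 2) :
    ∃ L : E →L[ℂ] lp (fun _ : ι => F) 2, ∀ x i, L x i = T i x := by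
  let L : E →ₗ[ℂ] lp (fun _ : ι => F) 2 :=
    { toFun := fun x => ⟨fun i => T i x, hT x⟩
      map_add' := fun x y => by ext i; exact map_add (T i) x y
      map_smul' := fun a x => by ext i; exact map_smul (T i) a x }
  refine ⟨⟨L, L.continuous_of_seq_closed_graph fun u x y hu hy => ?_⟩, fun _ _ => rfl⟩
  ext i
  have hTu : Filter.Tendsto (fun n => T i (u n)) Filter.atTop (nhds (T i x)) :=
    ((T i).continuous.tendsto x).comp hu
  have hLu : Filter.Tendsto (fun n => T i (u n)) Filter.atTop (nhds (y i)) :=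
    ((lp.evalCLM ℂ (fun _ : ι => F) 2 i).continuous.tendsto y).comp hy
  exact (tendsto_nhds_unique hTu hLu).symm

end Families

/-! ### Boundary values on the lattice -/

section Boundary

variable {l α β θ : ℝ} {V : ℝ → ℝ} {z c s s' : ℂ}

/-- The value at the point `0` of an edge which the node values `g` prescribe. -/
def startValue (β : ℝ) : Edge → (ℤ × ℤ → ℂ) →L[ℂ] ℂ
  | (m, n, Dir.r) => .proj (m, n)
  | (m, n, Dir.u) => (β : ℂ) • .proj (m, n)

/-- The value at the point `l` of an edge which the node values `g` prescribe. -/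
def endValue (β θ : ℝ) : Edge → (ℤ × ℤ → ℂ) →L[ℂ] ℂ
  | (m, n, Dir.r) => phase (n * θ) • .proj (m + 1, n)
  | (m, n, Dir.u) => ((β : ℂ) * phase (-(m * θ))) • .proj (m, n + 1)

/-- The weighted flow out of the node `(m, n)`, where `p e` leaves the edge `e` at its point `0`
and `q e` arrives at its point `l`. -/
def outflow (θ β : ℝ) (p q : Edge → ℂ) (m n : ℤ) : ℂ :=
  p (m, n, Dir.r) + (β : ℂ) * p (m, n, Dir.u)
    - phase (-(n * θ)) * q (m - 1, n, Dir.r) - (β : ℂ) * phase (m * θ) * q (m, n - 1, Dir.u)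

lemma forall_vertexValue_iff (hβ : β ≠ 0) {u : Edge → ℝ → ℂ} {g : ℤ × ℤ → ℂ} :
    (∀ m n, VertexValue l θ β u m n (g (m, n))) ↔
      ∀ e, u e 0 = startValue β e g ∧ u e l = endValue β θ e g := by
  have hβ' : (β : ℂ) ≠ 0 := by exact_mod_cast hβ
  have hphase (x : ℝ) {a b : ℂ} : phase x * a = b ↔ a = phase (-x) * b := by
    constructor <;> rintro rfl
    · rw [← mul_assoc, phase_neg_mul_phase, one_mul]
    · rw [← mul_assoc, phase_mul_phase_neg, one_mul]
  have hvertex (m n : ℤ) : VertexValue l θ β u m n (g (m, n)) ↔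
      u (m, n, Dir.r) 0 = startValue β (m, n, Dir.r) g ∧
      u (m, n, Dir.u) 0 = startValue β (m, n, Dir.u) g ∧
      u (m - 1, n, Dir.r) l = endValue β θ (m - 1, n, Dir.r) g ∧
      u (m, n - 1, Dir.u) l = endValue β θ (m, n - 1, Dir.u) g := by
    simp only [VertexValue, startValue, endValue, ContinuousLinearMap.proj_apply, smul_apply,
      smul_eq_mul, one_div, inv_mul_eq_iff_eq_mul₀ hβ', hphase, neg_neg, sub_add_cancel, mul_assoc,
      mul_left_comm (β : ℂ)]
  simp only [hvertex]
  refine ⟨fun h => ?_, fun h m n => ⟨(h _).1, (h _).1, (h _).2, (h _).2⟩⟩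
  rintro ⟨m, n, _ | _⟩
  · exact ⟨(h m n).1, by simpa only [add_sub_cancel_right] using (h (m + 1) n).2.2.1⟩
  · exact ⟨(h m n).2.1, by simpa only [add_sub_cancel_right] using (h m (n + 1)).2.2.2⟩

lemma memℓp_startValue (g : NodeL2) : Memℓp (fun e => startValue β e g) 2 :=
  memℓp_two_edge (lp.memℓp g) ((lp.memℓp g).const_smul (β : ℂ))

lemma memℓp_endValue (g : NodeL2) : Memℓp (fun e => endValue β θ e g) 2 := by
  have hg := lp.memℓp g
  refine memℓp_two_edge
    (memℓp_two_of_norm_le (memℓp_two_comp_injective hg (translate 1 0).injective) 1 fun i => ?_)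
    (memℓp_two_of_norm_le (memℓp_two_comp_injective hg (translate 0 1).injective) |β| fun i => ?_)
  · simp [endValue, translate, phase_norm, Prod.add_def]
  · simp [endValue, translate, phase_norm, Prod.add_def]

lemma memℓp_outflow {p q : Edge → ℂ} (hp : Memℓp p 2) (hq : Memℓp q 2) :
    Memℓp (fun i : ℤ × ℤ => outflow θ β p q i.1 i.2) 2 := by
  have hterm {f : Edge → ℂ} (hf : Memℓp f 2) (b : ℤ × ℤ → ℂ) (τ : ℤ × ℤ → Edge) (K : ℝ)
      (hτ : Function.Injective τ) (hb : ∀ i, ‖b i‖ ≤ K) : Memℓp (fun i => b i * f (τ i)) 2 :=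
    memℓp_two_of_norm_le (memℓp_two_comp_injective hf hτ) K fun i => by
      rw [norm_mul]
      gcongr
      exact hb i
  have hright := hterm hp (fun _ => 1) (fun i => (i.1, i.2, Dir.r)) 1
    (fun i j hij => by simp_all [Prod.ext_iff]) (by simp)
  have hup := hterm hp (fun _ => β) (fun i => (i.1, i.2, Dir.u)) |β|
    (fun i j hij => by simp_all [Prod.ext_iff]) (by simp)
  have hleft := hterm hq (fun i => phase (-(i.2 * θ))) (fun i => (i.1 - 1, i.2, Dir.r)) 1
    (fun i j hij => by simp_all [Prod.ext_iff]) (by simp [phase_norm])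
  have hdown := hterm hq (fun i => β * phase (i.1 * θ)) (fun i => (i.1, i.2 - 1, Dir.u)) |β|
    (fun i j hij => by simp_all [Prod.ext_iff]) (by simp [phase_norm])
  simp only [one_mul] at hright
  exact ((hright.add hup).sub hleft).sub hdown

lemma exists_outflow_clm (θ β : ℝ) (d₀ d₁ : EdgeL2 l →L[ℂ] ℂ) :
    ∃ Γ : LatticeL2 l →L[ℂ] NodeL2, ∀ k m n,
      Γ k (m, n) = outflow θ β (fun e => d₀ (k e)) (fun e => d₁ (k e)) m n := by
  let ev : Edge → LatticeL2 l →L[ℂ] EdgeL2 l := lp.evalCLM ℂ (fun _ : Edge => EdgeL2 l) 2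
  let T (i : ℤ × ℤ) : LatticeL2 l →L[ℂ] ℂ :=
    d₀ ∘L ev (i.1, i.2, Dir.r) + (β : ℂ) • (d₀ ∘L ev (i.1, i.2, Dir.u))
      - phase (-(i.2 * θ)) • (d₁ ∘L ev (i.1 - 1, i.2, Dir.r))
      - ((β : ℂ) * phase (i.1 * θ)) • (d₁ ∘L ev (i.1, i.2 - 1, Dir.u))
  have hT (i : ℤ × ℤ) (k : LatticeL2 l) :
      T i k = outflow θ β (fun e => d₀ (k e)) (fun e => d₁ (k e)) i.1 i.2 := rfl
  obtain ⟨Γ, hΓ⟩ := exists_clm_of_memℓp_two T fun k => by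
    simp only [hT]
    exact memℓp_outflow (memℓp_two_clm d₀ k) (memℓp_two_clm d₁ k)
  exact ⟨Γ, fun k m n => hΓ k (m, n)⟩

lemma outflow_boundaryValues (g : NodeL2) (d₀ d₁ : Edge → ℂ) (m n : ℤ) :
    outflow θ β (fun e => (endValue β θ e g - startValue β e g * c) / s + d₀ e)
        (fun e => (endValue β θ e g * s' - startValue β e g) / s + d₁ e) m n =
      (discreteLaplacian θ β g (m, n) - (1 + (β : ℂ) ^ 2) * (s' + c) * g (m, n)) / s
        + outflow θ β d₀ d₁ m n := by
  have hn := phase_mul_phase_neg (n * θ)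
  have hm := phase_mul_phase_neg (m * θ)
  rw [discreteLaplacian_apply]
  simp only [outflow, startValue, endValue, ContinuousLinearMap.proj_apply, smul_apply, smul_eq_mul,
    sub_add_cancel]
  linear_combination (-s' * g (m, n)) / s * hn - (β : ℂ) ^ 2 * s' * g (m, n) / s * hm

end Boundary

section LatticeResolvent

variable {l α β θ : ℝ} {V : ℝ → ℝ} {z c s s' : ℂ}

lemma mem_latticeGraph_iff_boundaryValues (hβ : β ≠ 0) {p : LatticeL2 l × LatticeL2 l} :
    p ∈ latticeGraph l V α β θ ↔ ∃ (u v w : Edge → ℝ → ℂ) (g : ℤ × ℤ → ℂ),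
      (∀ e, Represents l V (p.1 e) (p.2 e) (u e) (v e) (w e)) ∧
      (∀ e, u e 0 = startValue β e g ∧ u e l = endValue β θ e g) ∧
      ∀ m n, outflow θ β (fun e => v e 0) (fun e => v e l) m n = α * g (m, n) := by
  simp only [← forall_vertexValue_iff (l := l) hβ]
  constructor
  · rintro ⟨u, v, w, hrep, hvertex⟩
    choose g hg using hvertex
    exact ⟨u, v, w, fun i => g i.1 i.2, hrep, fun m n => (hg m n).1, fun m n => (hg m n).2⟩
  · rintro ⟨u, v, w, g, hrep, hval, hder⟩
    exact ⟨u, v, w, hrep, fun m n => ⟨g (m, n), hval m n, hder m n⟩⟩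

lemma memℓp_of_eq_startValue (hl : 0 < l) (D : DirichletSolver l V z c s s') {φ k : LatticeL2 l}
    {g : ℤ × ℤ → ℂ} {b : Edge → ℂ} (hφ : ∀ e,
      φ e = startValue β e g • D.startSol + b e • D.endSol + D.green (k e)) : Memℓp g 2 := by
  obtain ⟨K, hK⟩ := D.exists_norm_start_le hl
  have hstart : Memℓp (fun e => startValue β e g) 2 := by
    refine memℓp_two_of_norm_le ((lp.memℓp φ).sub (memℓp_two_clm D.green k)) K fun e => ?_
    rw [Pi.sub_apply, hφ, add_sub_cancel_right]
    exact hK _ _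
  exact memℓp_two_comp_injective hstart (τ := fun i : ℤ × ℤ => (i.1, i.2, Dir.r))
    fun i j hij => by simp_all [Prod.ext_iff]

lemma DirichletSolver.outflow_deriv_iff (D : DirichletSolver l V z c s s') (hs : s ≠ 0)
    {Γ : LatticeL2 l →L[ℂ] NodeL2} (hΓ : ∀ k m n, Γ k (m, n) =
      outflow θ β (fun e => D.startSource (k e)) (fun e => D.endSource (k e)) m n)
    {φ ψ : LatticeL2 l} {u v w : Edge → ℝ → ℂ} {g : NodeL2}
    (hrep : ∀ e, Represents l V (φ e) (ψ e) (u e) (v e) (w e))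
    (hval : ∀ e, u e 0 = startValue β e g ∧ u e l = endValue β θ e g) :
    (∀ m n, outflow θ β (fun e => v e 0) (fun e => v e l) m n = α * g (m, n)) ↔
      ((1 + (β : ℂ) ^ 2) * (s' + c) + α * s) • g - discreteLaplacian θ β g
        = s • Γ (ψ - z • φ) := by
  have hflow (m n : ℤ) : outflow θ β (fun e => v e 0) (fun e => v e l) m n =
      (discreteLaplacian θ β g (m, n) - (1 + (β : ℂ) ^ 2) * (s' + c) * g (m, n)) / s
        + Γ (ψ - z • φ) (m, n) := by
    simp only [D.deriv_start (hrep _), D.deriv_end (hrep _), hval]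
    exact (outflow_boundaryValues g _ _ m n).trans (congrArg _ (hΓ (ψ - z • φ) m n).symm)
  rw [lp.ext_iff, funext_iff, Prod.forall]
  refine forall₂_congr fun m n => ?_
  change _ ↔ ((1 + (β : ℂ) ^ 2) * (s' + c) + α * s) * g (m, n) - discreteLaplacian θ β g (m, n)
    = s * Γ (ψ - z • φ) (m, n)
  rw [hflow, div_add' _ _ _ hs, div_eq_iff hs]
  constructor <;> intro h <;> linear_combination -h

lemma mem_latticeGraph_iff (hl : 0 < l) (hβ : β ≠ 0) (hs : s ≠ 0)
    (D : DirichletSolver l V z c s s') {Γ : LatticeL2 l →L[ℂ] NodeL2}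
    (hΓ : ∀ k m n, Γ k (m, n) =
      outflow θ β (fun e => D.startSource (k e)) (fun e => D.endSource (k e)) m n)
    {p : LatticeL2 l × LatticeL2 l} :
    p ∈ latticeGraph l V α β θ ↔ ∃ g : NodeL2,
      ((1 + (β : ℂ) ^ 2) * (s' + c) + α * s) • g - discreteLaplacian θ β g
        = s • Γ (p.2 - z • p.1) ∧
      ∀ e, p.1 e = startValue β e g • D.startSol + endValue β θ e g • D.endSol
        + D.green (p.2 e - z • p.1 e) := by
  obtain ⟨φ, ψ⟩ := p
  rw [mem_latticeGraph_iff_boundaryValues hβ]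
  constructor
  · rintro ⟨u, v, w, g, hrep, hval, hder⟩
    have hφ (e : Edge) := D.eq_of_represents (hrep e)
    simp only [hval] at hφ
    let g' : NodeL2 := ⟨g, memℓp_of_eq_startValue hl D (k := ψ - z • φ) hφ⟩
    exact ⟨g', (D.outflow_deriv_iff (g := g') hs hΓ hrep hval).1 hder, hφ⟩
  · rintro ⟨g, hg, hφ⟩
    choose u v w hrep h₀ h₁ using fun e =>
      D.exists_represents (ψ e - z • φ e) (startValue β e g) (endValue β θ e g)
    simp only [← hφ, sub_add_cancel] at hrep
    have hval (e : Edge) := And.intro (h₀ e) (h₁ e)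
    exact ⟨u, v, w, g, hrep, hval, (D.outflow_deriv_iff hs hΓ hrep hval).2 hg⟩

lemma exists_latticeSolution_clm (D : DirichletSolver l V z c s s') :
    ∃ S : NodeL2 × LatticeL2 l →L[ℂ] LatticeL2 l, ∀ x e, S x e =
      startValue β e x.1 • D.startSol + endValue β θ e x.1 • D.endSol + D.green (x.2 e) := by
  let nodes : NodeL2 →L[ℂ] ℤ × ℤ → ℂ := .pi fun i => lp.evalCLM ℂ (fun _ => ℂ) 2 i
  let T (e : Edge) : NodeL2 × LatticeL2 l →L[ℂ] EdgeL2 l :=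
    ((startValue β e ∘L nodes).smulRight D.startSol
      + (endValue β θ e ∘L nodes).smulRight D.endSol) ∘L .fst ℂ _ _
        + (D.green ∘L lp.evalCLM ℂ (fun _ => EdgeL2 l) 2 e) ∘L .snd ℂ _ _
  have hT (x : NodeL2 × LatticeL2 l) (e : Edge) : T e x =
      startValue β e x.1 • D.startSol + endValue β θ e x.1 • D.endSol + D.green (x.2 e) := rfl
  have hmem (x : NodeL2 × LatticeL2 l) : Memℓp (fun e => T e x) 2 := by
    have hstart : Memℓp (fun e => startValue β e x.1 • D.startSol) 2 :=
      memℓp_two_smul_const (memℓp_startValue x.1) D.startSol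
    have hend : Memℓp (fun e => endValue β θ e x.1 • D.endSol) 2 :=
      memℓp_two_smul_const (memℓp_endValue x.1) D.endSol
    simp only [hT]
    exact (hstart.add hend).add (memℓp_two_clm D.green x.2)
  obtain ⟨S, hS⟩ := exists_clm_of_memℓp_two T hmem
  exact ⟨S, fun x e => (hS x e).trans (hT x e)⟩

theorem isResolventPoint_latticeOp (hl : 0 < l) (hβ : β ≠ 0) (hs : s ≠ 0)
    (D : DirichletSolver l V z c s s')
    (hη : (1 + (β : ℂ) ^ 2) * (s' + c) + α * s ∉ spectrum ℂ (discreteLaplacian θ β)) :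
    IsResolventPoint (latticeOp l V α β θ) z := by
  obtain ⟨A, hA⟩ := spectrum.notMem_iff.1 hη
  let A' := ContinuousLinearEquiv.ofUnit A
  have hA' (g : NodeL2) :
      A' g = ((1 + (β : ℂ) ^ 2) * (s' + c) + α * s) • g - discreteLaplacian θ β g :=
    DFunLike.congr_fun hA g
  obtain ⟨Γ, hΓ⟩ := exists_outflow_clm θ β D.startSource D.endSource
  obtain ⟨S, hS⟩ := exists_latticeSolution_clm (β := β) (θ := θ) D
  let N : LatticeL2 l →L[ℂ] NodeL2 := s • (A'.symm.toContinuousLinearMap ∘L Γ)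
  have hN (g : NodeL2) (k : LatticeL2 l) : A' g = s • Γ k ↔ g = N k := by
    rw [← A'.eq_symm_apply, map_smul]
    rfl
  refine isResolventPoint_iff.2 ⟨S ∘L N.prod (.id ℂ _), fun p => ?_⟩
  simp only [latticeOp_graph hl, mem_latticeGraph_iff hl hβ hs D hΓ, ← hA', hN, exists_eq_left]
  rw [lp.ext_iff, funext_iff]
  refine forall_congr' fun e => ?_
  rw [ContinuousLinearMap.comp_apply, hS]
  rfl

end LatticeResolvent

/-! ### Zeros of `u₁(l; ·)` belong to the spectrum -/

section DirichletPoints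

variable {l α β θ : ℝ} {V : ℝ → ℝ}

-- The two ways around the plaquette differ by the flux `phase (2 * θ) ≠ 1`.
lemma eq_zero_of_plaquette (hθ : ∀ k : ℤ, θ ≠ k) {ρ : ℂ} (hρ : ρ ≠ 0) {g : ℤ × ℤ → ℂ} {m n : ℤ}
    (hbottom : phase (n * θ) * g (m + 1, n) = ρ * g (m, n))
    (hright : phase (-((m + 1 : ℤ) * θ)) * g (m + 1, n + 1) = ρ * g (m + 1, n))
    (hleft : phase (-(m * θ)) * g (m, n + 1) = ρ * g (m, n))
    (htop : phase ((n + 1 : ℤ) * θ) * g (m + 1, n + 1) = ρ * g (m, n + 1)) : g (m, n) = 0 := by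
  have hflux : phase (n * θ) * phase (-((m + 1 : ℤ) * θ)) * phase (2 * θ) =
      phase (-(m * θ)) * phase ((n + 1 : ℤ) * θ) := by
    simp only [← phase_add]
    congr 1
    push_cast
    ring
  have hprod : (phase (2 * θ) - 1) * (ρ * ρ * g (m, n)) = 0 := by
    linear_combination (-phase (2 * θ)) * (phase (n * θ) * hright + ρ * hbottom)
      + (phase (-(m * θ)) * htop + ρ * hleft) + g (m + 1, n + 1) * hflux
  simpa [sub_eq_zero, phase_two_mul_ne_one hθ, hρ] using hprod

lemma eq_zero_of_endValue_eq (hβ : β ≠ 0) (hθ : ∀ k : ℤ, θ ≠ k) {ρ : ℂ} (hρ : ρ ≠ 0)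
    {g : ℤ × ℤ → ℂ} {m n : ℤ}
    (h : ∀ e ≠ (m, n, Dir.r), endValue β θ e g = ρ * startValue β e g) :
    g (m, n) = 0 ∧ g (m + 1, n) = 0 := by
  have hβ' : (β : ℂ) ≠ 0 := by exact_mod_cast hβ
  have hright {j k : ℤ} (hjk : (j, k) ≠ (m, n)) : phase (k * θ) * g (j + 1, k) = ρ * g (j, k) :=
    h (j, k, Dir.r) (by simpa [Prod.ext_iff] using hjk)
  have hup (j k : ℤ) : phase (-(j * θ)) * g (j, k + 1) = ρ * g (j, k) := by
    refine mul_left_cancel₀ hβ' ?_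
    have := h (j, k, Dir.u) (by simp)
    simp only [endValue, startValue, smul_apply, ContinuousLinearMap.proj_apply,
      smul_eq_mul] at this
    linear_combination this
  have hzero {j : ℤ} (hj : j ≠ m) : g (j, n) = 0 :=
    eq_zero_of_plaquette hθ hρ (hright (by simp [hj])) (hup _ n) (hup j n)
      (hright (by simp [hj]))
  have hleft := hright (j := m - 1) (k := n) (by simp)
  rw [sub_add_cancel, hzero (j := m - 1) (by simp), mul_zero] at hleft
  exact ⟨(mul_eq_zero.1 hleft).resolve_left (left_ne_zero_of_mul_eq_one (phase_mul_phase_neg _)),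
    hzero (by simp)⟩

lemma IsFundamental.ofReal_sub {x : ℝ} {c c' s s' : ℝ → ℝ}
    (h : IsFundamental l (fun t => V t - x) c c' s s') :
    IsFundamental l (fun t => (V t : ℂ) - x) (fun t => (c t : ℂ)) (fun t => (c' t : ℂ))
      (fun t => (s t : ℂ)) (fun t => (s' t : ℂ)) := by
  simpa only [Complex.ofReal_sub] using h.ofReal

lemma IsFundamental.exists_integral_sin_clm {q c c' s s' : ℝ → ℝ} (hl : 0 < l)
    (h : IsFundamental l q c c' s s') :
    ∃ I : EdgeL2 l →L[ℂ] ℂ, (∀ k, I k = ∫ t in (0 : ℝ)..l, k t * s t) ∧ ∃ k, I k ≠ 0 := by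
  have hs := h.ofReal.sin.fst.continuousOn
  obtain ⟨I, hI⟩ := exists_integral_clm hs (right_mem_Icc.2 hl.le)
  have hmem := memLp_of_continuousOn hs 2
  refine ⟨I, hI, hmem.toLp, ?_⟩
  have hsq : I hmem.toLp = ((∫ t in (0 : ℝ)..l, s t * s t : ℝ) : ℂ) := by
    rw [hI, ← intervalIntegral.integral_ofReal]
    refine intervalIntegral.integral_congr_ae_restrict ?_
    rw [uIoc_of_le hl.le]
    filter_upwards [ae_restrict_of_ae_restrict_of_subset Ioc_subset_Icc_self hmem.coeFn_toLp]
      with t ht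
    rw [ht, Complex.ofReal_mul]
  rw [hsq]
  exact_mod_cast (h.integral_sin_sq_pos hl).ne'

theorem IsFundamental.mem_realSpec_latticeOp (hl : 0 < l) (hβ : β ≠ 0) (hθ : ∀ k : ℤ, θ ≠ k) {μ : ℝ}
    {c c' s s' : ℝ → ℝ} (h : IsFundamental l (fun t => V t - μ) c c' s s') (hs : s l = 0) :
    μ ∈ realSpec (latticeOp l V α β θ) := by
  classical
  intro hres
  have hll : l ∈ Icc (0 : ℝ) l := right_mem_Icc.2 hl.le
  obtain ⟨I, hI, k₀, hk₀⟩ := h.exists_integral_sin_clm hl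
  have hc : (c l : ℂ) ≠ 0 := by
    have hwr := h.wronskian hll
    rw [hs, mul_zero, sub_zero] at hwr
    exact_mod_cast left_ne_zero_of_mul_eq_one hwr
  -- A source on the single edge `e₀` cannot be matched by any choice of node values.
  let e₀ : Edge := (0, 0, Dir.r)
  let k : LatticeL2 l := lp.single 2 e₀ k₀
  obtain ⟨R, hR⟩ := isResolventPoint_iff.1 hres
  have hgraph := (hR (R k, k + (μ : ℂ) • R k)).2 (by simp)
  rw [latticeOp_graph hl, mem_latticeGraph_iff_boundaryValues hβ] at hgraph
  obtain ⟨u, v, w, g, hrep, hval, -⟩ := hgraph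
  have hend (e : Edge) : endValue β θ e g = c l * (startValue β e g + I (k e)) := by
    have hsol := (hrep e).isSol hl.le μ
    rw [show (k + (μ : ℂ) • R k) e - (μ : ℂ) • R k e = k e from add_sub_cancel_right _ _] at hsol
    have hul := (h.ofReal_sub.eq_fst_and_eq_snd hsol hll).1
    rw [(hval e).1, (hval e).2, hs, ← hI] at hul
    rw [hul]
    simp only [Complex.ofReal_zero, mul_zero, zero_mul, add_zero, sub_zero]
    ring
  obtain ⟨h₀, h₁⟩ := eq_zero_of_endValue_eq hβ hθ hc (g := g) (m := 0) (n := 0) fun e he => by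
    rw [hend, lp.single_apply_ne _ _ _ he, map_zero, add_zero]
  rw [zero_add] at h₁
  have hcontra := hend e₀
  simp [e₀, k, endValue, startValue, h₀, h₁, hc, hk₀] at hcontra

end DirichletPoints

/-! ### Dirichlet eigenvalues and the function `η` -/

section Eta

variable {l : ℝ} {V : ℝ → ℝ} {z y : ℂ}

lemma IsSolution.isSol {a b : ℂ} {u v : ℝ → ℂ} (hl : 0 ≤ l) (h : IsSolution l V z a b u v) :
    IsSol l (fun t => V t - z) (fun _ => 0) u v := by
  obtain ⟨w, hH2, heq, -, -⟩ := h
  refine hH2.isSol hl ?_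
  filter_upwards [heq] with t ht
  linear_combination -ht

lemma IsSol.isSolution {u v : ℝ → ℂ} (hV : MemLp V 2 (edgeMeasure l))
    (h : IsSol l (fun t => V t - z) (fun _ => 0) u v) : IsSolution l V z (u 0) (v 0) u v :=
  ⟨_, h.isH2 hV MemLp.zero', .of_forall fun t => by ring, rfl, rfl⟩

variable {c c' s s' : ℝ → ℂ} (h : IsFundamental l (fun t => V t - z) c c' s s')
include h

lemma IsFundamental.isEta_iff (hV : MemLp V 2 (edgeMeasure l)) (α β : ℝ) :
    IsEta l V α β z y ↔ y = (1 + (β : ℂ) ^ 2) * (s' l + c l) + α * s l := by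
  have hll : l ∈ Icc (0 : ℝ) l := right_mem_Icc.2 h.nonneg
  constructor
  · rintro ⟨u₁, v₁, u₂, v₂, h₁, h₂, rfl⟩
    obtain ⟨hu₁, hv₁⟩ := h.eq_of_homogeneous (h₁.isSol h.nonneg) hll
    obtain ⟨hu₂, -⟩ := h.eq_of_homogeneous (h₂.isSol h.nonneg) hll
    obtain ⟨-, -, -, hu₁0, hv₁0⟩ := h₁
    obtain ⟨-, -, -, hu₂0, hv₂0⟩ := h₂
    simp only [hu₁, hv₁, hu₂, hu₁0, hv₁0, hu₂0, hv₂0, zero_mul, one_mul, zero_add, add_zero]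
  · rintro rfl
    have hs := h.sin.isSolution hV
    have hc := h.cos.isSolution hV
    rw [h.sin_zero, h.sin_deriv_zero] at hs
    rw [h.cos_zero, h.cos_deriv_zero] at hc
    exact ⟨s, s', c, c', hs, hc, rfl⟩

lemma IsFundamental.sin_eq_zero_of_isEigenvalue (hl : 0 < l)
    (hz : IsEigenvalue (dirichletOp l V) z) : s l = 0 := by
  obtain ⟨f, hf, hfz⟩ := hz
  have hgraph := (dirichletOp l V).mem_graph f
  rw [hfz, dirichletOp_graph hl] at hgraph
  obtain ⟨u, v, w, hrep, hu0, hul⟩ := hgraph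
  have hsol := hrep.isSol hl.le z
  rw [sub_self] at hsol
  have hhom : IsSol l (fun t => V t - z) (fun _ => 0) u v := hsol.congr_ae <| by
    filter_upwards [Lp.coeFn_zero ℂ 2 (edgeMeasure l)] with t ht
    rw [ht, Pi.zero_apply]
  have hend := (h.eq_of_homogeneous hhom (right_mem_Icc.2 hl.le)).1
  rw [hu0, hul, zero_mul, zero_add] at hend
  refine (mul_eq_zero.1 hend.symm).resolve_left fun hv0 => hf ?_
  refine Lp.eq_zero_iff_ae_eq_zero.2 (hrep.left.trans ?_)
  filter_upwards [ae_restrict_mem measurableSet_Icc] with t ht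
  rw [(h.eq_of_homogeneous hhom ht).1, hu0, hv0, zero_mul, zero_mul, add_zero, Pi.zero_apply]

end Eta

section Gaps

variable {l α β θ : ℝ} {V : ℝ → ℝ}

lemma abs_lt_of_mem_spectrum_discreteLaplacian (hβ : β ≠ 0) (hθ : ∀ k : ℤ, θ ≠ k) {y : ℝ}
    (hy : (y : ℂ) ∈ spectrum ℂ (discreteLaplacian θ β)) : |y| < 2 * (1 + β ^ 2) := by
  have hle := spectrum.norm_le_norm_of_mem hy
  rw [Complex.norm_real, Real.norm_eq_abs] at hle
  exact hle.trans_lt (norm_discreteLaplacian_lt hβ hθ)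

lemma two_le_add_of_mul_eq_one {a b : ℝ} (ha : 0 < a) (h : b * a = 1) : 2 ≤ a + b := by
  have hb : 0 < b := pos_of_mul_pos_left (h ▸ one_pos) ha.le
  nlinarith [sq_nonneg (a - b)]

namespace FundamentalFamily

variable (F : FundamentalFamily l V) {x μ : ℝ}

lemma isEta_discriminant (hV : MemLp V 2 (edgeMeasure l)) (α β x : ℝ) {y : ℂ} :
    IsEta l V α β x y ↔ y = F.discriminant α β l x := by
  rw [(F.isFundamental x).ofReal_sub.isEta_iff hV, discriminant]
  push_cast
  rfl

lemma bandSet_eq_preimage (hV : MemLp V 2 (edgeMeasure l)) (α β θ : ℝ) :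
    bandSet l V α β θ =
      (fun x => (F.discriminant α β l x : ℂ)) ⁻¹' spectrum ℂ (discreteLaplacian θ β) := by
  ext x
  simp [bandSet, F.isEta_discriminant hV]

lemma cos_mul_sinDeriv_eq_one (hx : F.sin x l = 0) : F.cos x l * F.sinDeriv x l = 1 := by
  have hwr := (F.isFundamental x).wronskian (right_mem_Icc.2 F.nonneg)
  rwa [hx, mul_zero, sub_zero] at hwr

lemma le_discriminant_of_sinDeriv_pos (α β : ℝ) (hx : F.sin x l = 0) (hx' : 0 < F.sinDeriv x l) :
    2 * (1 + β ^ 2) ≤ F.discriminant α β l x := by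
  have h := two_le_add_of_mul_eq_one hx' (F.cos_mul_sinDeriv_eq_one hx)
  rw [discriminant, hx]
  nlinarith [sq_nonneg β]

lemma discriminant_le_of_sinDeriv_neg (α β : ℝ) (hx : F.sin x l = 0) (hx' : F.sinDeriv x l < 0) :
    F.discriminant α β l x ≤ -(2 * (1 + β ^ 2)) := by
  have h := two_le_add_of_mul_eq_one (neg_pos.2 hx') (b := -F.cos x l)
    (by rw [neg_mul_neg, F.cos_mul_sinDeriv_eq_one hx])
  rw [discriminant, hx]
  nlinarith [sq_nonneg β]

lemma le_abs_discriminant (α β : ℝ) (hx : F.sin x l = 0) :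
    2 * (1 + β ^ 2) ≤ |F.discriminant α β l x| := by
  rcases (right_ne_zero_of_mul_eq_one (F.cos_mul_sinDeriv_eq_one hx)).lt_or_gt with h | h
  · exact (le_neg_of_le_neg (F.discriminant_le_of_sinDeriv_neg α β hx h)).trans (neg_le_abs _)
  · exact (F.le_discriminant_of_sinDeriv_pos α β hx h).trans (le_abs_self _)

lemma mem_realSpec_latticeOp (hl : 0 < l) (hβ : β ≠ 0) (hθ : ∀ k : ℤ, θ ≠ k)
    (hμ : F.sin μ l = 0) : μ ∈ realSpec (latticeOp l V α β θ) :=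
  (F.isFundamental μ).mem_realSpec_latticeOp hl hβ hθ hμ

lemma notMem_realSpec_latticeOp (hl : 0 < l) (hV : MemLp V 2 (edgeMeasure l)) (hβ : β ≠ 0)
    (hx : F.sin x l ≠ 0) (hband : x ∉ bandSet l V α β θ) :
    x ∉ realSpec (latticeOp l V α β θ) := by
  obtain ⟨D⟩ := (F.isFundamental x).ofReal_sub.nonempty_dirichletSolver hV (by exact_mod_cast hx)
  refine not_not.2 (isResolventPoint_latticeOp hl hβ (by exact_mod_cast hx) D ?_)
  simpa [F.bandSet_eq_preimage hV, discriminant] using hband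

theorem exists_isGap_bandSet (hl : 0 < l) (hV : MemLp V 2 (edgeMeasure l)) (α : ℝ) (hβ : β ≠ 0)
    (hθ : ∀ k : ℤ, θ ≠ k) (hμ : F.sin μ l = 0) :
    ∃ a b, IsGap (bandSet l V α β θ) a b ∧ μ ∈ Ioo a b ∧
      Ioo a b ∩ realSpec (latticeOp l V α β θ) = {μ} := by
  have hVint : IntegrableOn V (Icc 0 l) := hV.integrable (by norm_num)
  have hll : l ∈ Ioc (0 : ℝ) l := right_mem_Ioc.2 hl
  obtain ⟨σ, hσ⟩ := exists_real_mem_spectrum_discreteLaplacian θ β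
  have hband := F.bandSet_eq_preimage hV α β θ
  have hcont := F.continuous_discriminant (right_mem_Icc.2 hl.le) α β
  have hclosed : IsClosed (bandSet l V α β θ) := by
    rw [hband]
    exact (spectrum.isClosed _).preimage (Complex.continuous_ofReal.comp hcont)
  have hμband : μ ∉ bandSet l V α β θ := fun h => by
    rw [hband] at h
    exact (F.le_abs_discriminant α β hμ).not_gt (abs_lt_of_mem_spectrum_discreteLaplacian hβ hθ h)
  have hsign : IsSignDeriv (F.sin · l) (F.sinDeriv · l) :=
    fun x => F.eventually_sign_sin_near_zero hl
  obtain ⟨a, b, hgap, hmem, hunique⟩ := hsign.exists_isGap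
    (F.continuous_sin (right_mem_Icc.2 hl.le)) hcont
    (fun _ => F.le_discriminant_of_sinDeriv_pos α β)
    (fun _ => F.discriminant_le_of_sinDeriv_neg α β)
    (F.eventually_sin_pos_atBot hVint hll) (F.tendsto_discriminant_atBot hVint hll α β)
    (F.exists_sin_eq_zero_gt hVint hll μ) hclosed
    (abs_lt_of_mem_spectrum_discreteLaplacian hβ hθ hσ)
    (fun x hx => by rwa [hband, mem_preimage, show F.discriminant α β l x = σ from hx]) hμ hμband
  refine ⟨a, b, hgap, hmem, Subset.antisymm ?_ ?_⟩
  · rintro y ⟨hy, hyspec⟩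
    by_contra hne
    exact F.notMem_realSpec_latticeOp hl hV hβ (fun h => hne (hunique y hy h))
      (disjoint_left.1 hgap.2.2.2 hy) hyspec
  · rintro y rfl
    exact ⟨hmem, F.mem_realSpec_latticeOp hl hβ hθ hμ⟩

end FundamentalFamily

lemma exists_isGap_right_of_isolated {T : Set ℝ} (hT : IsClosed T) {μ b ν : ℝ} (hμT : μ ∈ T)
    (hμb : μ < b) (hiso : Disjoint (Ioo μ b) T) (hν : μ < ν) (hνT : ν ∈ T) :
    ∃ c, IsGap T μ c := by
  have hbν : b ≤ ν := not_lt.1 fun h => disjoint_left.1 hiso ⟨hν, h⟩ hνT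
  obtain ⟨x, hμx, hxb⟩ := exists_between hμb
  obtain ⟨a, c, hgap, hx, hμa, -⟩ := exists_isGap_of_isClosed hT hμx (hxb.trans_le hbν) hμT hνT
    (disjoint_left.1 hiso ⟨hμx, hxb⟩)
  obtain rfl : μ = a := hμa.eq_of_not_lt fun h =>
    disjoint_left.1 hiso ⟨h, hx.1.trans hxb⟩ hgap.2.1
  exact ⟨c, hgap⟩

theorem infinite_isGap_realSpec_latticeOp (hl : 0 < l) (hV : MemLp V 2 (edgeMeasure l)) (α : ℝ)
    (hβ : β ≠ 0) (hθ : ∀ k : ℤ, θ ≠ k) :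
    {p : ℝ × ℝ | IsGap (realSpec (latticeOp l V α β θ)) p.1 p.2}.Infinite := by
  obtain ⟨F⟩ := nonempty_fundamentalFamily hl.le (V := V) (hV.integrable (by norm_num))
  have hzeros := F.exists_sin_eq_zero_gt (hV.integrable (by norm_num)) (right_mem_Ioc.2 hl)
  have hinf : {μ : ℝ | F.sin μ l = 0}.Infinite := infinite_of_not_bddAbove fun ⟨X, hX⟩ =>
    have ⟨_, hx, hx0⟩ := hzeros X
    (hX hx0).not_gt hx
  refine .of_image Prod.fst (hinf.mono fun μ hμ => ?_)
  obtain ⟨a, b, -, hmem, hab⟩ := F.exists_isGap_bandSet hl hV α hβ hθ hμ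
  obtain ⟨ν, hν, hν0⟩ := hzeros μ
  have hiso : Disjoint (Ioo μ b) (realSpec (latticeOp l V α β θ)) := disjoint_left.2 fun y hy hys =>
    hy.1.ne' (hab.subset ⟨⟨hmem.1.trans hy.1, hy.2⟩, hys⟩)
  obtain ⟨c, hc⟩ := exists_isGap_right_of_isolated (isClosed_realSpec _)
    (F.mem_realSpec_latticeOp hl hβ hθ hμ) hmem.2 hiso hν (F.mem_realSpec_latticeOp hl hβ hθ hν0)
  exact ⟨(μ, c), hc, rfl⟩

end Gaps

end MagneticLattice

end

theorem mainTheorem3 (l : ℝ) (hl : 0 < l) (V : ℝ → ℝ)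
    (hV : MeasureTheory.MemLp V 2 (MeasureTheory.volume.restrict (Set.Icc 0 l)))
    (α β θ : ℝ) (hβ : β ≠ 0) (hθ : ∀ k : ℤ, θ ≠ k) :
    {p : ℝ × ℝ | MagneticLattice.IsGap
      (MagneticLattice.realSpec (MagneticLattice.latticeOp l V α β θ)) p.1 p.2}.Infinite ∧
    (∀ μ : ℝ, MagneticLattice.IsEigenvalue (MagneticLattice.dirichletOp l V) μ →
      ∃ a b : ℝ, MagneticLattice.IsGap (MagneticLattice.bandSet l V α β θ) a b ∧
        μ ∈ Set.Ioo a b ∧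
        Set.Ioo a b ∩ MagneticLattice.realSpec (MagneticLattice.latticeOp l V α β θ) = {μ}) ∧
    ‖MagneticLattice.discreteLaplacian θ β‖ < 2 * (1 + β ^ 2) ∧
    (∀ μ : ℝ, MagneticLattice.IsEigenvalue (MagneticLattice.dirichletOp l V) μ →
      ∃ y : ℂ, MagneticLattice.IsEta l V α β μ y ∧ 2 * (1 + β ^ 2) ≤ ‖y‖) := by
  obtain ⟨F⟩ := MagneticLattice.nonempty_fundamentalFamily hl.le (V := V)
    (hV.integrable (by norm_num))
  have hzero (μ : ℝ) (hμ : MagneticLattice.IsEigenvalue (MagneticLattice.dirichletOp l V) μ) :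
      F.sin μ l = 0 := by
    exact_mod_cast (F.isFundamental μ).ofReal_sub.sin_eq_zero_of_isEigenvalue hl hμ
  refine ⟨MagneticLattice.infinite_isGap_realSpec_latticeOp hl hV α hβ hθ,
    fun μ hμ => F.exists_isGap_bandSet hl hV α hβ hθ (hzero μ hμ),
    MagneticLattice.norm_discreteLaplacian_lt hβ hθ,
    fun μ hμ => ⟨F.discriminant α β l μ, (F.isEta_discriminant hV α β μ).2 rfl, ?_⟩⟩
  rw [Complex.norm_real, Real.norm_eq_abs]
  exact F.le_abs_discriminant α β (hzero μ hμ)
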